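/- Let $\Omega\subseteq\mathbb C$ be an open set. Let $A^\infty(\Omega)$ be the space of holomorphic functions $f$ on $\Omega$ all of whose derivatives $f^{(\ell)}$, $\ell=0,1,2,\dots$, extend continuously to $\overline\Omega$ (the extensions are again denoted $f^{(\ell)}$), with the topology of uniform convergence of every derivative on every compact subset of $\overline\Omega$. Let $X^\infty$ be the closure in $A^\infty(\Omega)$ of the set of (restrictions to $\Omega$ of) functions that are holomorphic on some open set containing $\overline\Omega$. For $f\in A^\infty(\Omega)$, $\zeta\in\overline\Omega$ and $p,q\in\{0,1,2,\dots\}$ put $a_v=f^{(v)}(\zeta)/v!$ for $v\ge 0$ and $a_v=0$ for $v<0$. Write $f\in\mathcal D_{p,q}(\zeta)$ if the Hankel determinant $\det(a_{p-q+1+i+j})_{0\le i,j<q}$ is not zero (for $q=0$ the determinant is $1$). In that case there is a unique pair of polynomials $N,D$ with $\deg N\le p$, $\deg D\le q$, $D(0)=1$ such that the Taylor coefficients at $\zeta$ of orders $0,\dots,p+q$ of $[p/q]_{f,\zeta}(z)=N(z-\zeta)/D(z-\zeta)$ are $a_0,\dots,a_{p+q}$; this rational function is the Padé approximant of $f$ centred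 at $\zeta$. **Theorem 6.5.** Let $\mathcal F\subseteq\mathbb N\times\mathbb N$ contain a sequence $(\tilde p_n,\tilde q_n)$ with $\tilde p_n\to+\infty$ and $\tilde q_n\to+\infty$, and let $\zeta_0\in\overline\Omega$. Then there exist a function $f\in A^\infty(\Omega)$ and a sequence $(p_n,q_n)$, $n=1,2,\dots$, in $\mathcal F$ such that $f\in\mathcal D_{p_n,q_n}(\zeta_0)$ for all $n$ and, for every compact set $K\subseteq\overline\Omega$ and every $\ell=0,1,2,\dots$, $$\sup_{z\in K}\bigl|[p_n/q_n]_{f,\zeta_0}^{(\ell)}(z)-f^{(\ell)}(z)\bigr|\to 0\quad\text{as } n\to\infty$$ (in particular $[p_n/q_n]_{f,\zeta_0}$ has no poles in $K$ for all large $n$). Moreover, the set of all functions $f\in A^\infty(\Omega)$ for which such a sequence exists is a subset of $X^\infty$, and it is a dense $G_\delta$ subset of $X^\infty$. -/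

import Mathlib

open Set Filter Topology Polynomial

noncomputable section

/-- A function on `Ω`, extended by `0` to the whole plane. It only serves to speak of complex
derivatives at points of the open set `Ω`, where the values outside `Ω` do not matter. -/
def zeroExtend {Ω : Set ℂ} (f : Ω → ℂ) : ℂ → ℂ :=
  Function.extend Subtype.val f 0

/-- The space `A^∞(Ω)`: holomorphic functions on the open set `Ω` all of whose derivatives
`f^(l)`, `l = 0, 1, 2, …`, extend continuously to the closure of `Ω`. -/
structure AInfty (Ω : Set ℂ) where
  /-- the underlying function on `Ω` -/
  toFun : Ω → ℂ
  holomorphic : DifferentiableOn ℂ (zeroExtend toFun) Ω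
  extends_continuously : ∀ l : ℕ, ∃ g : C(closure Ω, ℂ), ∀ z : Ω,
    g (Set.inclusion subset_closure z) = iteratedDeriv l (zeroExtend toFun) z

namespace AInfty

variable {Ω : Set ℂ}

/-- The continuous extension of the derivative `f^(l)` to the closure of `Ω`
(it is unique, because `Ω` is dense in its closure). -/
def extDeriv (f : AInfty Ω) (l : ℕ) : C(closure Ω, ℂ) :=
  (f.extends_continuously l).choose

theorem extDeriv_apply (f : AInfty Ω) (l : ℕ) (z : Ω) :
    f.extDeriv l (Set.inclusion subset_closure z) = iteratedDeriv l (zeroExtend f.toFun) z :=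
  (f.extends_continuously l).choose_spec z

/-- The topology of `A^∞(Ω)`: uniform convergence of every derivative on every compact subset of
the closure of `Ω`. Here `C(closure Ω, ℂ)` carries the compact-open topology, which is that of
uniform convergence on compact sets, and the sequences of such functions the product topology. -/
instance : TopologicalSpace (AInfty Ω) :=
  TopologicalSpace.induced (fun f => (f.extDeriv : ℕ → C(closure Ω, ℂ))) inferInstance

/-- The Taylor coefficients `f^(v)(ζ) / v!` of `f` at a point `ζ` of the closure of `Ω`. -/
def taylorCoeff (f : AInfty Ω) (ζ : closure Ω) (v : ℕ) : ℂ :=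
  f.extDeriv v ζ / (v.factorial : ℂ)

end AInfty

/-- The elements of `A^∞(Ω)` that come from functions holomorphic on some open set containing
the closure of `Ω`. -/
def holomorphicNearClosure (Ω : Set ℂ) : Set (AInfty Ω) :=
  {f | ∃ U : Set ℂ, IsOpen U ∧ closure Ω ⊆ U ∧
    ∃ g : ℂ → ℂ, DifferentiableOn ℂ g U ∧ ∀ z : Ω, f.toFun z = g z}

/-- The space `X^∞`: the closure in `A^∞(Ω)` of the functions holomorphic near the closure
of `Ω`. -/
def XInfty (Ω : Set ℂ) : Set (AInfty Ω) :=
  closure (holomorphicNearClosure Ω)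

/-- The coefficients `a_i` of a formal series with an integer index, where `a_i = 0` for `i < 0`. -/
def coeffInt (a : ℕ → ℂ) (i : ℤ) : ℂ :=
  if 0 ≤ i then a i.toNat else 0

/-- The `q × q` Hankel matrix with entries `a_{p-q+1+i+j}`, `0 ≤ i, j < q`. -/
def hankelMatrix (a : ℕ → ℂ) (p q : ℕ) : Matrix (Fin q) (Fin q) ℂ :=
  Matrix.of fun i j => coeffInt a ((p : ℤ) - (q : ℤ) + 1 + (i : ℕ) + (j : ℕ))

/-- The rational function `N / D`, in the local variable `z - ζ`, is a `[p / q]` Padé approximant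
of `∑ a_v (z - ζ)^v`: `deg N ≤ p`, `deg D ≤ q`, `D(0) = 1`, and the Taylor coefficients of `N / D`
of order `0, …, p + q` are those of the given series. -/
structure IsPadeApproximant (a : ℕ → ℂ) (p q : ℕ) (N D : ℂ[X]) : Prop where
  natDegree_num_le : N.natDegree ≤ p
  natDegree_den_le : D.natDegree ≤ q
  den_coeff_zero : D.coeff 0 = 1
  coeff_eq : ∀ v ≤ p + q,
    PowerSeries.coeff v ((N : PowerSeries ℂ) * (D : PowerSeries ℂ)⁻¹) = a v

open Classical in
/-- Numerator and denominator, in the local variable `z - ζ`, of the Padé approximant `[p / q]`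
of the series with coefficients `a` (`(0, 1)` if there is none). If the Hankel determinant does
not vanish, then this pair exists, is unique and is coprime. -/
def padePair (a : ℕ → ℂ) (p q : ℕ) : ℂ[X] × ℂ[X] :=
  if h : ∃ R : ℂ[X] × ℂ[X], IsPadeApproximant a p q R.1 R.2 then h.choose else (0, 1)

namespace AInfty

variable {Ω : Set ℂ}

/-- The class `D_{p,q}(ζ)`: the Hankel determinant of the Taylor coefficients of `f` at `ζ` is not
zero, so that the Padé approximant `[p / q]_{f, ζ}` exists and is unique. -/
def InPadeClass (f : AInfty Ω) (p q : ℕ) (ζ : closure Ω) : Prop :=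
  (hankelMatrix (f.taylorCoeff ζ) p q).det ≠ 0

/-- The numerator of `[p / q]_{f, ζ}` as a function of `z`. -/
def padeNum (f : AInfty Ω) (p q : ℕ) (ζ : closure Ω) (z : ℂ) : ℂ :=
  (padePair (f.taylorCoeff ζ) p q).1.eval (z - ζ)

/-- The denominator of `[p / q]_{f, ζ}` as a function of `z`. -/
def padeDen (f : AInfty Ω) (p q : ℕ) (ζ : closure Ω) (z : ℂ) : ℂ :=
  (padePair (f.taylorCoeff ζ) p q).2.eval (z - ζ)

/-- The Padé approximant `[p / q]_{f, ζ}` as a function of `z`; its poles are the zeros of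
`padeDen`. -/
def pade (f : AInfty Ω) (p q : ℕ) (ζ : closure Ω) (z : ℂ) : ℂ :=
  f.padeNum p q ζ z / f.padeDen p q ζ z

/-- There is a sequence `(p_n, q_n)` in `F` such that `f ∈ D_{p_n,q_n}(ζ)` for all `n` and, for
every compact subset `K` of the closure of `Ω` and every `l`, the supremum over `z ∈ K` of
`|[p_n / q_n]_{f,ζ}^(l)(z) - f^(l)(z)|` tends to `0`. This supremum is infinite if there is a pole
in `K`, hence the requirement that there be none in `K` for large `n`. -/
def IsApproximatedByPade (f : AInfty Ω) (F : Set (ℕ × ℕ)) (ζ : closure Ω) : Prop :=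
  ∃ p q : ℕ → ℕ, (∀ n, (p n, q n) ∈ F) ∧ (∀ n, f.InPadeClass (p n) (q n) ζ) ∧
    ∀ K : Set (closure Ω), IsCompact K →
      (∀ᶠ n in atTop, ∀ z ∈ K, f.padeDen (p n) (q n) ζ z ≠ 0) ∧
      ∀ l : ℕ, TendstoUniformlyOn
        (fun n (z : closure Ω) => iteratedDeriv l (f.pade (p n) (q n) ζ) z)
        (f.extDeriv l) atTop K

end AInfty

end

/-! The set is a `G_δ` because it is described by countably many open conditions: for every `n` some
pair of `F` has an approximant within `1 / (n + 1)` of `f`, up to the `n`-th derivative, on the part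
of the closure of `Ω` in the disc of radius `n` (`isApproximatedByPade_iff`). Each condition is open
(`isOpen_padeClose`), since by Cramer's rule the Padé coefficients are continuous in finitely many
Taylor coefficients wherever the Hankel determinant does not vanish.

Density needs no Baire argument, because explicit rational functions belong to the set. Runge's
theorem approximates a function holomorphic near the closure by a rational one on a compact part,
and `exists_rational_approx_push_poles` removes the remaining poles from the closure. Write the
result as a coprime fraction `N / D` in `z - ζ` and add `d (z - ζ) ^ T` with `d ≠ 0` small and `T =
p - deg D`. The numerator then has degree exactly `p`, which forces a nonzero Hankel determinant
(`hankelMatrix_det_ne_zero`), so the fraction is its own approximant `[p / q]` and a constant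
sequence of pairs works.

The inclusion in `X^∞` rests on the same removal of poles, applied to the Padé approximants
themselves. -/

noncomputable section

/-! ### Algebra of Padé approximants and Hankel determinants -/

theorem coeffInt_natCast (a : ℕ → ℂ) (n : ℕ) : coeffInt a n = a n := by
  simp [coeffInt]

theorem coeffInt_of_neg (a : ℕ → ℂ) {i : ℤ} (hi : i < 0) : coeffInt a i = 0 := by
  simp [coeffInt, not_le.2 hi]

/-- Coefficients of the product of a polynomial with a power series. -/
theorem PowerSeries.coeff_polynomial_mul_mk (a : ℕ → ℂ) (P : ℂ[X]) {m : ℕ} (hP : P.natDegree < m)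
    (n : ℕ) :
    PowerSeries.coeff n ((P : PowerSeries ℂ) * PowerSeries.mk a) =
      ∑ k ∈ Finset.range m, P.coeff k * coeffInt a ((n : ℤ) - k) := by
  rw [PowerSeries.coeff_mul, Finset.Nat.sum_antidiagonal_eq_sum_range_succ_mk]
  have h1 : ∀ k ∈ Finset.range (n + 1),
      PowerSeries.coeff k (P : PowerSeries ℂ) * PowerSeries.coeff (n - k) (PowerSeries.mk a) =
        P.coeff k * coeffInt a ((n : ℤ) - k) := by
    intro k hk
    have hk : k ≤ n := by simpa [Nat.lt_succ_iff] using hk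
    rw [← Nat.cast_sub hk, coeffInt_natCast, Polynomial.coeff_coe, PowerSeries.coeff_mk]
  rw [Finset.sum_congr rfl h1]
  rcases le_total m (n + 1) with h | h
  · symm
    apply Finset.sum_subset (Finset.range_mono h)
    intro k _ hk
    rw [P.coeff_eq_zero_of_natDegree_lt (by simp at hk; omega), zero_mul]
  · apply Finset.sum_subset (Finset.range_mono h)
    intro k _ hk
    rw [coeffInt_of_neg a (by simp at hk; omega), mul_zero]

/-- Clearing the denominator makes the conditions linear in `D`. As `D` is invertible as a power
series, multiplying by it or its inverse preserves divisibility by `X ^ (p + q + 1)`. -/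
theorem isPadeApproximant_iff {a : ℕ → ℂ} {p q : ℕ} {N D : ℂ[X]} :
    IsPadeApproximant a p q N D ↔ N.natDegree ≤ p ∧ D.natDegree ≤ q ∧ D.coeff 0 = 1 ∧
      ∀ v ≤ p + q,
        PowerSeries.coeff v ((D : PowerSeries ℂ) * PowerSeries.mk a) = N.coeff v := by
  have key (hD : D.coeff 0 = 1) :
      (∀ v ≤ p + q, PowerSeries.coeff v ((N : PowerSeries ℂ) * (D : PowerSeries ℂ)⁻¹) = a v) ↔
      ∀ v ≤ p + q,
        PowerSeries.coeff v ((D : PowerSeries ℂ) * PowerSeries.mk a) = N.coeff v := by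
    have hD' : PowerSeries.constantCoeff (D : PowerSeries ℂ) ≠ 0 := by
      simp [hD]
    have e1 : (∀ v ≤ p + q,
        PowerSeries.coeff v ((N : PowerSeries ℂ) * (D : PowerSeries ℂ)⁻¹) = a v) ↔
        (PowerSeries.X : PowerSeries ℂ) ^ (p + q + 1) ∣
          (N : PowerSeries ℂ) * (D : PowerSeries ℂ)⁻¹ - PowerSeries.mk a := by
      rw [PowerSeries.X_pow_dvd_iff]
      simp [sub_eq_zero]
    have e2 : (∀ v ≤ p + q,
        PowerSeries.coeff v ((D : PowerSeries ℂ) * PowerSeries.mk a) = N.coeff v) ↔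
        (PowerSeries.X : PowerSeries ℂ) ^ (p + q + 1) ∣
          (D : PowerSeries ℂ) * PowerSeries.mk a - N := by
      rw [PowerSeries.X_pow_dvd_iff]
      simp [sub_eq_zero]
    rw [e1, e2]
    have hmul : (D : PowerSeries ℂ)⁻¹ * D = 1 := PowerSeries.inv_mul_cancel _ hD'
    constructor
    · intro h
      have := h.mul_left (-(D : PowerSeries ℂ))
      convert this using 1
      linear_combination (N : PowerSeries ℂ) * hmul
    · intro h
      have := h.mul_left (-(D : PowerSeries ℂ)⁻¹)
      convert this using 1
      linear_combination (PowerSeries.mk a) * hmul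
  constructor
  · rintro ⟨h1, h2, h3, h4⟩
    exact ⟨h1, h2, h3, (key h3).1 h4⟩
  · rintro ⟨h1, h2, h3, h4⟩
    exact ⟨h1, h2, h3, (key h3).2 h4⟩

/-- The coefficients of order `p + 1, …, p + q` of `D * ∑ a_v X^v` in terms of the Hankel matrix. -/
theorem coeff_mul_mk_eq_hankel (a : ℕ → ℂ) (p q : ℕ) {D : ℂ[X]} (hD : D.natDegree ≤ q)
    (h0 : D.coeff 0 = 1) (i : Fin q) :
    PowerSeries.coeff (p + 1 + i) ((D : PowerSeries ℂ) * PowerSeries.mk a) =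
      (hankelMatrix a p q).mulVec (fun j => D.coeff (q - j)) i + a (p + 1 + i) := by
  rw [PowerSeries.coeff_polynomial_mul_mk a D (Nat.lt_succ_of_le hD), Finset.sum_range_succ', h0]
  congr 1
  -- The reflection `k ↦ q - 1 - j` turns `D.coeff (k + 1)` into `D.coeff (q - j)` and the index `p
  -- + i - k` into the Hankel index.
  · rw [Matrix.mulVec, dotProduct, ← Finset.sum_range_reflect, Finset.sum_range]
    refine Finset.sum_congr rfl fun j _ => ?_
    have hj := j.2
    rw [mul_comm, hankelMatrix, Matrix.of_apply]
    congr 2 <;> omega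
  · rw [← coeffInt_natCast a (p + 1 + i)]; simp

/-- The coefficients of the Padé denominator, in reversed order and without the constant one,
given by Cramer's rule. -/
def padeDenVec (a : ℕ → ℂ) (p q : ℕ) : Fin q → ℂ :=
  (hankelMatrix a p q)⁻¹.mulVec (fun i => -a (p + 1 + i))

/-- Since `deg N ≤ p`, the coefficients of orders `p + 1, …, p + q` of `D * ∑ a_v X^v` vanish. This
is a linear system with the Hankel matrix, here invertible. -/
theorem IsPadeApproximant.den_eq_padeDenVec {a : ℕ → ℂ} {p q : ℕ} {N D : ℂ[X]}
    (h : IsPadeApproximant a p q N D) (hdet : (hankelMatrix a p q).det ≠ 0) (j : Fin q) :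
    D.coeff (q - j) = padeDenVec a p q j := by
  obtain ⟨h1, h2, h3, h4⟩ := isPadeApproximant_iff.1 h
  have : (hankelMatrix a p q).mulVec (fun j => D.coeff (q - j)) =
      fun i : Fin q => -a (p + 1 + i) := by
    ext i
    have e := coeff_mul_mk_eq_hankel a p q h2 h3 i
    rw [h4 _ (by omega), N.coeff_eq_zero_of_natDegree_lt (by omega)] at e
    exact eq_neg_of_add_eq_zero_left e.symm
  rw [padeDenVec, ← this, Matrix.mulVec_mulVec, Matrix.nonsing_inv_mul _ (Ne.isUnit hdet),
    Matrix.one_mulVec]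

/-- A formula in terms of `a` alone serves both uniqueness and, later, continuity in `f`. With
truncated subtraction the inner condition means `1 ≤ k ≤ q`. -/
theorem IsPadeApproximant.den_coeff {a : ℕ → ℂ} {p q : ℕ} {N D : ℂ[X]}
    (h : IsPadeApproximant a p q N D) (hdet : (hankelMatrix a p q).det ≠ 0) (k : ℕ) :
    D.coeff k = if k = 0 then 1 else
      if hk : q - k < q ∧ k ≤ q then padeDenVec a p q ⟨q - k, hk.1⟩ else 0 := by
  split_ifs with h0 hk
  · rw [h0, h.den_coeff_zero]
  · rw [← h.den_eq_padeDenVec hdet]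
    congr 1
    simp only
    omega
  · exact D.coeff_eq_zero_of_natDegree_lt (by have := h.natDegree_den_le; omega)

theorem IsPadeApproximant.num_coeff {a : ℕ → ℂ} {p q : ℕ} {N D : ℂ[X]}
    (h : IsPadeApproximant a p q N D) (k : ℕ) :
    N.coeff k = if k ≤ p then
      ∑ j ∈ Finset.range (q + 1), D.coeff j * coeffInt a ((k : ℤ) - j) else 0 := by
  obtain ⟨h1, h2, h3, h4⟩ := isPadeApproximant_iff.1 h
  split_ifs with hk
  · rw [← h4 k (by omega), PowerSeries.coeff_polynomial_mul_mk a D (Nat.lt_succ_of_le h2)]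
  · exact N.coeff_eq_zero_of_natDegree_lt (by omega)

theorem IsPadeApproximant.unique {a : ℕ → ℂ} {p q : ℕ} {N D N' D' : ℂ[X]}
    (h : IsPadeApproximant a p q N D) (h' : IsPadeApproximant a p q N' D')
    (hdet : (hankelMatrix a p q).det ≠ 0) : N = N' ∧ D = D' := by
  have hD : D = D' := by
    ext k
    rw [h.den_coeff hdet, h'.den_coeff hdet]
  refine ⟨?_, hD⟩
  ext k
  rw [h.num_coeff, h'.num_coeff, hD]

theorem exists_isPadeApproximant {a : ℕ → ℂ} {p q : ℕ} (hdet : (hankelMatrix a p q).det ≠ 0) :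
    ∃ N D : ℂ[X], IsPadeApproximant a p q N D := by
  set d : ℕ → ℂ := fun k => if k = 0 then 1 else
      if hk : q - k < q ∧ k ≤ q then padeDenVec a p q ⟨q - k, hk.1⟩ else 0 with hd
  set φ : PowerSeries ℂ := PowerSeries.mk d with hφ
  set D : ℂ[X] := PowerSeries.trunc (q + 1) φ with hD
  have hDdeg : D.natDegree ≤ q := Nat.lt_succ_iff.1 (PowerSeries.natDegree_trunc_lt _ _)
  have hD0 : D.coeff 0 = 1 := by simp [hD, PowerSeries.coeff_trunc, hφ, hd]
  have hDv : (fun j : Fin q => D.coeff (q - j)) = padeDenVec a p q := by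
    ext j
    have := j.2
    rw [hD, PowerSeries.coeff_trunc, if_pos (by omega), hφ, PowerSeries.coeff_mk, hd]
    simp only
    rw [if_neg (by omega), dif_pos (by omega)]
    congr 1
    ext
    simp only
    omega
  refine ⟨PowerSeries.trunc (p + 1) ((D : PowerSeries ℂ) * PowerSeries.mk a), D,
    isPadeApproximant_iff.2
      ⟨Nat.lt_succ_iff.1 (PowerSeries.natDegree_trunc_lt _ _), hDdeg, hD0, fun v hv => ?_⟩⟩
  rw [PowerSeries.coeff_trunc]
  split_ifs with hvp
  · rfl
  · obtain ⟨i, rfl⟩ : ∃ i, v = p + 1 + i := ⟨v - (p + 1), by omega⟩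
    have e := coeff_mul_mk_eq_hankel a p q hDdeg hD0 ⟨i, by omega⟩
    rw [hDv, padeDenVec, Matrix.mulVec_mulVec, Matrix.mul_nonsing_inv _ (Ne.isUnit hdet),
      Matrix.one_mulVec] at e
    simpa using e

theorem padePair_spec {a : ℕ → ℂ} {p q : ℕ} (hdet : (hankelMatrix a p q).det ≠ 0) :
    IsPadeApproximant a p q (padePair a p q).1 (padePair a p q).2 := by
  obtain ⟨N, D, h⟩ := exists_isPadeApproximant hdet
  have h' : ∃ R : ℂ[X] × ℂ[X], IsPadeApproximant a p q R.1 R.2 := ⟨(N, D), h⟩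
  rw [padePair, dif_pos h']
  exact h'.choose_spec

theorem IsPadeApproximant.padePair_eq {a : ℕ → ℂ} {p q : ℕ} {N D : ℂ[X]}
    (h : IsPadeApproximant a p q N D) (hdet : (hankelMatrix a p q).det ≠ 0) :
    padePair a p q = (N, D) := by
  obtain ⟨h1, h2⟩ := (padePair_spec hdet).unique h hdet
  exact Prod.ext h1 h2

theorem padePair_num_natDegree_le (a : ℕ → ℂ) (p q : ℕ) : (padePair a p q).1.natDegree ≤ p := by
  rw [padePair]
  split_ifs with h
  · exact h.choose_spec.natDegree_num_le
  · simp

theorem padePair_den_natDegree_le (a : ℕ → ℂ) (p q : ℕ) : (padePair a p q).2.natDegree ≤ q := by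
  rw [padePair]
  split_ifs with h
  · exact h.choose_spec.natDegree_den_le
  · simp

theorem padePair_den_coeff_zero (a : ℕ → ℂ) (p q : ℕ) : (padePair a p q).2.coeff 0 = 1 := by
  rw [padePair]
  split_ifs with h
  · exact h.choose_spec.den_coeff_zero
  · simp

/-- The Hankel determinant does not vanish for the Taylor coefficients of an irreducible fraction
whose numerator has the maximal degree. -/
theorem hankelMatrix_det_ne_zero {a : ℕ → ℂ} {p q : ℕ} {N D : ℂ[X]}
    (hN : N.natDegree = p) (hp : 0 < p) (hD : D.natDegree ≤ q)
    (hND : IsCoprime N D) (h : (D : PowerSeries ℂ) * PowerSeries.mk a = N) :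
    (hankelMatrix a p q).det ≠ 0 := by
  intro hdet
  -- A kernel vector is read as a polynomial `C ≠ 0` of degree `< q`, for which `C * ∑ a_v X^v`
  -- agrees with some `P` of degree `< p` up to order `p + q - 1`. Multiplying by `D` gives `C N = P
  -- D`, as both sides have degree `< p + q`. Then `N ∣ P` by coprimality, so `P = 0` by degree, and
  -- `C N = 0`, a contradiction.
  obtain ⟨c, hc0, hc⟩ := Matrix.exists_mulVec_eq_zero_iff.2 hdet
  have hq : 0 < q := by
    rcases Nat.eq_zero_or_pos q with rfl | h
    · exact absurd (Subsingleton.elim c 0) hc0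
    · exact h
  set d : ℕ → ℂ := fun k => if hk : q - 1 - k < q then c ⟨q - 1 - k, hk⟩ else 0 with hd
  set C : ℂ[X] := PowerSeries.trunc q (PowerSeries.mk d) with hC
  have hCdeg : C.natDegree < q := by
    obtain ⟨q, rfl⟩ : ∃ m, q = m + 1 := ⟨q - 1, by omega⟩
    exact PowerSeries.natDegree_trunc_lt _ _
  have hCj : ∀ j : Fin q, C.coeff (q - 1 - j) = c j := by
    intro j
    have := j.2
    rw [hC, PowerSeries.coeff_trunc, if_pos (by omega), PowerSeries.coeff_mk, hd]
    simp only
    rw [dif_pos (by omega)]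
    congr 1
    ext
    simp only
    omega
  have hC0 : C ≠ 0 := by
    intro h
    apply hc0
    ext j
    rw [← hCj, h]; simp
  have hcoef : ∀ i : Fin q,
      PowerSeries.coeff (p + i) ((C : PowerSeries ℂ) * PowerSeries.mk a) = 0 := by
    intro i
    rw [PowerSeries.coeff_polynomial_mul_mk a C hCdeg, ← Finset.sum_range_reflect,
      Finset.sum_range]
    have := congrFun hc i
    rw [Matrix.mulVec, dotProduct] at this
    rw [Pi.zero_apply] at this
    rw [← this]
    refine Finset.sum_congr rfl fun j _ => ?_
    have hj := j.2
    rw [hCj, mul_comm, hankelMatrix, Matrix.of_apply]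
    congr 2
    push_cast [Nat.sub_sub]
    omega
  set P : ℂ[X] := PowerSeries.trunc p ((C : PowerSeries ℂ) * PowerSeries.mk a) with hP
  have hPdeg : P.natDegree < p := by
    obtain ⟨p, rfl⟩ : ∃ m, p = m + 1 := ⟨p - 1, by omega⟩
    exact PowerSeries.natDegree_trunc_lt _ _
  have hdvd : (PowerSeries.X : PowerSeries ℂ) ^ (p + q) ∣
      (C : PowerSeries ℂ) * PowerSeries.mk a - P := by
    rw [PowerSeries.X_pow_dvd_iff]
    intro m hm
    rw [map_sub, Polynomial.coeff_coe, hP, PowerSeries.coeff_trunc]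
    split_ifs with hmp
    · simp
    · have := hcoef ⟨m - p, by omega⟩
      simp only [show p + (m - p) = m by omega] at this
      simp [this]
  have hdvd' : (PowerSeries.X : PowerSeries ℂ) ^ (p + q) ∣ ((C * N - P * D : ℂ[X]) : PowerSeries ℂ) := by
    have := hdvd.mul_left (D : PowerSeries ℂ)
    convert this using 1
    push_cast
    rw [← h]
    ring
  have hCN : C * N = P * D := by
    rw [← sub_eq_zero]
    ext m
    rcases lt_or_ge m (p + q) with hm | hm
    · have := PowerSeries.X_pow_dvd_iff.1 hdvd' m hm
      rwa [Polynomial.coeff_coe] at this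
    · apply coeff_eq_zero_of_natDegree_lt
      refine lt_of_le_of_lt (natDegree_sub_le _ _) (max_lt ?_ ?_)
      · have := natDegree_mul_le (p := C) (q := N)
        omega
      · have := natDegree_mul_le (p := P) (q := D)
        omega
  have hNP : N ∣ P := hND.dvd_of_dvd_mul_right ⟨C, by rw [← hCN, mul_comm]⟩
  have hP0 : P = 0 := eq_zero_of_dvd_of_natDegree_lt hNP (by omega)
  have hN0 : N ≠ 0 := by
    rintro rfl
    simp at hN
    omega
  rw [hP0, zero_mul] at hCN
  exact (mul_ne_zero hC0 hN0) hCN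

/-! ### Derivatives and Taylor series of polynomials and their quotients -/

theorem DifferentiableOn.iteratedDeriv_of_isOpen {U : Set ℂ} (hU : IsOpen U) {g : ℂ → ℂ}
    (hg : DifferentiableOn ℂ g U) (l : ℕ) : DifferentiableOn ℂ (iteratedDeriv l g) U := by
  induction l with
  | zero => simpa using hg
  | succ l ih => rw [iteratedDeriv_succ]; exact ih.deriv hU

theorem iteratedDeriv_polynomial_eval (P : ℂ[X]) (l : ℕ) :
    iteratedDeriv l (fun z => P.eval z) = fun z => (derivative^[l] P).eval z := by
  induction l with
  | zero => simp
  | succ l ih =>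
    rw [iteratedDeriv_succ, ih, Function.iterate_succ_apply']
    ext z
    exact Polynomial.deriv _

theorem iteratedDeriv_polynomial_eval_sub (P : ℂ[X]) (ζ : ℂ) (v : ℕ) :
    iteratedDeriv v (fun z => P.eval (z - ζ)) ζ / (v.factorial : ℂ) = P.coeff v := by
  have := iteratedDeriv_comp_sub_const v (fun z => P.eval z) ζ
  rw [this, iteratedDeriv_polynomial_eval]
  simp only [sub_self]
  rw [← Polynomial.coeff_zero_eq_eval_zero, Polynomial.coeff_iterate_derivative]
  have h : (v.factorial : ℂ) ≠ 0 := by exact_mod_cast v.factorial_ne_zero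
  simp [Nat.descFactorial_self, h]

/-- The Taylor series of a quotient of polynomials. -/
theorem polynomial_mul_taylorSeries {r : ℂ → ℂ} {ζ : ℂ} (hr : AnalyticAt ℂ r ζ) {N D : ℂ[X]}
    (h : ∀ᶠ z in 𝓝 ζ, D.eval (z - ζ) * r z = N.eval (z - ζ)) :
    (D : PowerSeries ℂ) * PowerSeries.mk (fun v => iteratedDeriv v r ζ / (v.factorial : ℂ)) = N := by
  ext n
  have hD : ContDiffAt ℂ n (fun z => D.eval (z - ζ)) ζ := by
    have : ContDiff ℂ n (fun z => D.eval z) := D.differentiable.contDiff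
    exact (this.comp (contDiff_id.sub contDiff_const)).contDiffAt
  -- Leibniz' rule divided by `n!` is the Cauchy product of the two Taylor series.
  have e := iteratedDeriv_mul hD hr.contDiffAt (n := n)
  have e' : iteratedDeriv n ((fun z => D.eval (z - ζ)) * r) ζ =
      iteratedDeriv n (fun z => N.eval (z - ζ)) ζ :=
    Filter.EventuallyEq.iteratedDeriv_eq n h
  rw [Polynomial.coeff_coe, ← iteratedDeriv_polynomial_eval_sub N ζ n, ← e', e,
    PowerSeries.coeff_mul, Finset.Nat.sum_antidiagonal_eq_sum_range_succ_mk, Finset.sum_div]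
  refine Finset.sum_congr rfl fun i hi => ?_
  have hi : i ≤ n := by simpa [Nat.lt_succ_iff] using hi
  rw [Polynomial.coeff_coe, PowerSeries.coeff_mk, ← iteratedDeriv_polynomial_eval_sub D ζ i,
    Nat.cast_choose ℂ hi]
  have h1 : (i.factorial : ℂ) ≠ 0 := by exact_mod_cast i.factorial_ne_zero
  have h2 : ((n - i).factorial : ℂ) ≠ 0 := by exact_mod_cast (n - i).factorial_ne_zero
  have h3 : (n.factorial : ℂ) ≠ 0 := by exact_mod_cast n.factorial_ne_zero
  field_simp

/-! ### Compact exhaustion and the topology of `A^∞(Ω)` -/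

/-- The part of the closure of `Ω` in the closed disc of radius `n` about the origin. -/
def closurePart (Ω : Set ℂ) (n : ℕ) : Set (closure Ω) :=
  {z | ‖(z : ℂ)‖ ≤ n}

theorem isCompact_image_closurePart (Ω : Set ℂ) (n : ℕ) :
    IsCompact (closure Ω ∩ Metric.closedBall (0 : ℂ) n) :=
  (isCompact_closedBall _ _).inter_left isClosed_closure

theorem isCompact_closurePart (Ω : Set ℂ) (n : ℕ) : IsCompact (closurePart Ω n) := by
  rw [Subtype.isCompact_iff]
  convert isCompact_image_closurePart Ω n using 1
  ext z
  simp [closurePart, and_comm]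

theorem exists_subset_closurePart {Ω : Set ℂ} {K : Set (closure Ω)} (hK : IsCompact K) :
    ∃ m, ∀ n ≥ m, K ⊆ closurePart Ω n := by
  obtain ⟨C, hC⟩ := hK.exists_bound_of_continuousOn (f := fun z => (z : ℂ))
    continuous_subtype_val.continuousOn
  obtain ⟨m, hm⟩ := exists_nat_ge C
  exact ⟨m, fun n hn z hz => (hC z hz).trans (hm.trans (by exact_mod_cast hn))⟩

namespace AInfty

variable {Ω : Set ℂ}

/-- `extDeriv` is obtained by choice; density of `Ω` in its closure identifies it with any other
continuous extension, which makes it computable. -/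
theorem extDeriv_eq_of_eqOn (f : AInfty Ω) (l : ℕ) (g : C(closure Ω, ℂ))
    (hg : ∀ z : Ω, g (Set.inclusion subset_closure z) = iteratedDeriv l (zeroExtend f.toFun) z) :
    f.extDeriv l = g := by
  have hd : DenseRange (Set.inclusion (subset_closure (s := Ω))) := by
    rw [denseRange_inclusion_iff]
  ext1 z
  refine congrFun (hd.equalizer (f.extDeriv l).continuous g.continuous ?_) z
  ext z
  simp [hg, extDeriv_apply]

theorem zeroExtend_eventuallyEq (hΩ : IsOpen Ω) {f : Ω → ℂ} {g : ℂ → ℂ}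
    (h : ∀ z : Ω, f z = g z) {z : ℂ} (hz : z ∈ Ω) : zeroExtend f =ᶠ[𝓝 z] g := by
  filter_upwards [hΩ.mem_nhds hz] with w hw
  rw [← h ⟨w, hw⟩]
  exact Subtype.val_injective.extend_apply f 0 ⟨w, hw⟩

/-- The element of `A^∞(Ω)` given by a function holomorphic near the closure of `Ω`. -/
def ofHolomorphic (hΩ : IsOpen Ω) {U : Set ℂ} (hU : IsOpen U) (hΩU : closure Ω ⊆ U) (g : ℂ → ℂ)
    (hg : DifferentiableOn ℂ g U) : AInfty Ω where
  toFun z := g z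
  holomorphic z hz := by
    have h := zeroExtend_eventuallyEq hΩ (f := fun z : Ω => g z) (g := g) (fun _ => rfl) hz
    exact (((hg z (hΩU (subset_closure hz))).differentiableAt
      (hU.mem_nhds (hΩU (subset_closure hz)))).congr_of_eventuallyEq h).differentiableWithinAt
  extends_continuously l := by
    refine ⟨⟨fun z => iteratedDeriv l g z, ?_⟩, fun z => ?_⟩
    · exact continuousOn_iff_continuous_domRestrict.1
        ((hg.iteratedDeriv_of_isOpen hU l).continuousOn.mono hΩU)
    · exact ((zeroExtend_eventuallyEq hΩ (f := fun z : Ω => g z) (g := g) (fun _ => rfl)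
        z.2).iteratedDeriv_eq l).symm

theorem ofHolomorphic_mem (hΩ : IsOpen Ω) {U : Set ℂ} (hU : IsOpen U) (hΩU : closure Ω ⊆ U)
    (g : ℂ → ℂ) (hg : DifferentiableOn ℂ g U) :
    ofHolomorphic hΩ hU hΩU g hg ∈ holomorphicNearClosure Ω :=
  ⟨U, hU, hΩU, g, hg, fun _ => rfl⟩

theorem extDeriv_eq_iteratedDeriv (hΩ : IsOpen Ω) {U : Set ℂ} (hU : IsOpen U)
    (hΩU : closure Ω ⊆ U) {g : ℂ → ℂ} (hg : DifferentiableOn ℂ g U) {f : AInfty Ω}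
    (hf : ∀ z : Ω, f.toFun z = g z) (l : ℕ) (z : closure Ω) :
    f.extDeriv l z = iteratedDeriv l g z := by
  have hc : Continuous fun z : closure Ω => iteratedDeriv l g z :=
    continuousOn_iff_continuous_domRestrict.1
      ((hg.iteratedDeriv_of_isOpen hU l).continuousOn.mono hΩU)
  rw [f.extDeriv_eq_of_eqOn l ⟨_, hc⟩ fun z => ?_]
  · rfl
  · exact ((zeroExtend_eventuallyEq hΩ hf z.2).iteratedDeriv_eq l).symm

theorem continuous_extDeriv (l : ℕ) :
    Continuous fun f : AInfty Ω => f.extDeriv l :=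
  (continuous_apply l).comp (continuous_induced_dom (f := fun f : AInfty Ω =>
    (f.extDeriv : ℕ → C(closure Ω, ℂ))))

/-- Local compactness makes evaluation jointly continuous in the function and the point. -/
instance : LocallyCompactSpace (closure Ω : Set ℂ) :=
  isClosed_closure.isClosedEmbedding_subtypeVal.locallyCompactSpace

theorem continuous_extDeriv_apply (l : ℕ) :
    Continuous fun x : AInfty Ω × closure Ω => x.1.extDeriv l x.2 :=
  ((continuous_extDeriv l).comp continuous_fst).eval continuous_snd

theorem continuous_taylorCoeff (ζ : closure Ω) (v : ℕ) :
    Continuous fun f : AInfty Ω => f.taylorCoeff ζ v :=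
  ((continuous_extDeriv_apply v).comp (continuous_id.prodMk continuous_const)).div_const _

/-- A criterion for membership in a closure in `A^∞(Ω)`. -/
theorem mem_closure_of_approx {S : Set (AInfty Ω)} {f : AInfty Ω}
    (h : ∀ n : ℕ, ∀ ε > 0, ∃ s ∈ S, ∀ l ≤ n, ∀ z ∈ closurePart Ω n,
      ‖s.extDeriv l z - f.extDeriv l z‖ < ε) : f ∈ closure S := by
  choose s hsS hs using fun n : ℕ => h n (1 / ((n : ℝ) + 1)) (by positivity)
  refine mem_closure_of_tendsto (f := s) (b := atTop) ?_ (Eventually.of_forall hsS)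
  rw [(Topology.IsInducing.induced fun f : AInfty Ω =>
    (f.extDeriv : ℕ → C(closure Ω, ℂ))).tendsto_nhds_iff, tendsto_pi_nhds]
  intro l
  rw [ContinuousMap.tendsto_iff_forall_isCompact_tendstoUniformlyOn]
  intro K hK
  obtain ⟨m, hm⟩ := exists_subset_closurePart hK
  rw [Metric.tendstoUniformlyOn_iff]
  intro ε hε
  filter_upwards [eventually_ge_atTop m, eventually_ge_atTop l,
    (tendsto_one_div_add_atTop_nhds_zero_nat (𝕜 := ℝ)).eventually_lt_const hε] with n h1 h2 h3 z hz
  rw [dist_comm, dist_eq_norm]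
  exact (hs n l h2 z (hm n h1 hz)).trans h3

end AInfty

/-! ### Continuous dependence of the approximants on `f`, and the `G_δ` property -/

/-- The numerator of the `l`-th derivative of `N / D`, over the denominator `D ^ (l + 1)`. -/
def quotientDerivNum (N D : ℂ[X]) : ℕ → ℂ[X]
  | 0 => N
  | l + 1 => derivative (quotientDerivNum N D l) * D -
      C ((l : ℂ) + 1) * (quotientDerivNum N D l * derivative D)

/-- This expresses the derivatives of the approximants by polynomials in the coefficients of `N` and
`D`, so that they inherit continuity in `f`. -/
theorem iteratedDeriv_quotient (N D : ℂ[X]) (ζ : ℂ) (l : ℕ) {z : ℂ} (hz : D.eval (z - ζ) ≠ 0) :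
    iteratedDeriv l (fun z => N.eval (z - ζ) / D.eval (z - ζ)) z =
      (quotientDerivNum N D l).eval (z - ζ) / D.eval (z - ζ) ^ (l + 1) := by
  have hder (P : ℂ[X]) (w : ℂ) :
      HasDerivAt (fun z => P.eval (z - ζ)) ((derivative P).eval (w - ζ)) w := by
    simpa using (P.hasDerivAt (w - ζ)).comp_sub_const w ζ
  induction l generalizing z with
  | zero => simp [quotientDerivNum]
  | succ l ih =>
    have hev : iteratedDeriv l (fun z => N.eval (z - ζ) / D.eval (z - ζ)) =ᶠ[𝓝 z]
        fun z => (quotientDerivNum N D l).eval (z - ζ) / D.eval (z - ζ) ^ (l + 1) := by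
      filter_upwards [(hder D z).continuousAt.eventually_ne hz] with w hw using ih hw
    rw [iteratedDeriv_succ, hev.deriv_eq,
      ((hder _ z).fun_div ((hder D z).fun_pow (l + 1)) (pow_ne_zero _ hz)).deriv]
    simp only [quotientDerivNum, eval_sub, eval_mul, eval_C, Nat.add_sub_cancel, Nat.cast_add,
      Nat.cast_one]
    field_simp
    ring

section ContinuousFamilies

variable {A : Type*} [TopologicalSpace A]

/-- A family of polynomials of bounded degree whose coefficients are continuous at `f₀`. -/
def ContinuousCoeffAt (Q : A → ℂ[X]) (f₀ : A) : Prop :=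
  (∃ d, ∀ f, (Q f).natDegree ≤ d) ∧ ∀ k, ContinuousAt (fun f => (Q f).coeff k) f₀

theorem ContinuousCoeffAt.mul {Q R : A → ℂ[X]} {f₀ : A} (hQ : ContinuousCoeffAt Q f₀)
    (hR : ContinuousCoeffAt R f₀) : ContinuousCoeffAt (fun f => Q f * R f) f₀ := by
  obtain ⟨⟨d, hd⟩, hQ⟩ := hQ
  obtain ⟨⟨e, he⟩, hR⟩ := hR
  refine ⟨⟨d + e, fun f => natDegree_mul_le.trans (add_le_add (hd f) (he f))⟩, fun k => ?_⟩
  simp only [coeff_mul]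
  exact tendsto_finsetSum _ fun i _ => (hQ i.1).mul (hR i.2)

theorem ContinuousCoeffAt.sub {Q R : A → ℂ[X]} {f₀ : A} (hQ : ContinuousCoeffAt Q f₀)
    (hR : ContinuousCoeffAt R f₀) : ContinuousCoeffAt (fun f => Q f - R f) f₀ := by
  obtain ⟨⟨d, hd⟩, hQ⟩ := hQ
  obtain ⟨⟨e, he⟩, hR⟩ := hR
  refine ⟨⟨max d e, fun f => (natDegree_sub_le _ _).trans (max_le_max (hd f) (he f))⟩,
    fun k => ?_⟩
  simp only [coeff_sub]
  exact (hQ k).sub (hR k)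

theorem ContinuousCoeffAt.derivative {Q : A → ℂ[X]} {f₀ : A} (hQ : ContinuousCoeffAt Q f₀) :
    ContinuousCoeffAt (fun f => Polynomial.derivative (Q f)) f₀ := by
  obtain ⟨⟨d, hd⟩, hQ⟩ := hQ
  refine ⟨⟨d, fun f => ((Q f).natDegree_derivative_le.trans (Nat.sub_le _ _)).trans (hd f)⟩,
    fun k => ?_⟩
  simp only [coeff_derivative]
  exact (hQ (k + 1)).mul continuousAt_const

theorem ContinuousCoeffAt.const (P : ℂ[X]) (f₀ : A) : ContinuousCoeffAt (fun _ => P) f₀ :=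
  ⟨⟨_, fun _ => le_rfl⟩, fun _ => continuousAt_const⟩

theorem ContinuousCoeffAt.quotientDerivNum {N D : A → ℂ[X]} {f₀ : A}
    (hN : ContinuousCoeffAt N f₀) (hD : ContinuousCoeffAt D f₀) (l : ℕ) :
    ContinuousCoeffAt (fun f => quotientDerivNum (N f) (D f) l) f₀ := by
  induction l with
  | zero => exact hN
  | succ l ih =>
    exact (ih.derivative.mul hD).sub ((ContinuousCoeffAt.const _ _).mul (ih.mul hD.derivative))

/-- The uniform degree bound writes the value as a finite sum of fixed length, so continuity of each
coefficient suffices. -/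
theorem ContinuousCoeffAt.continuousAt_eval {Z : Type*} [TopologicalSpace Z] {Q : A → ℂ[X]}
    {f₀ : A} (hQ : ContinuousCoeffAt Q f₀) {φ : Z → ℂ} (hφ : Continuous φ) (z₀ : Z) :
    ContinuousAt (fun x : A × Z => (Q x.1).eval (φ x.2)) (f₀, z₀) := by
  obtain ⟨⟨d, hd⟩, hQ⟩ := hQ
  have : (fun x : A × Z => (Q x.1).eval (φ x.2)) =
      fun x => ∑ i ∈ Finset.range (d + 1), (Q x.1).coeff i * φ x.2 ^ i := by
    ext x
    exact eval_eq_sum_range' (Nat.lt_succ_of_le (hd x.1)) _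
  rw [this]
  refine tendsto_finsetSum _ fun i _ => ?_
  exact ((hQ i).comp_of_eq (f := Prod.fst) continuousAt_fst rfl).mul
    ((hφ.comp continuous_snd).pow i).continuousAt

end ContinuousFamilies

namespace AInfty

variable {Ω : Set ℂ}

theorem continuous_hankelMatrix (p q : ℕ) (ζ : closure Ω) :
    Continuous fun f : AInfty Ω => hankelMatrix (f.taylorCoeff ζ) p q := by
  refine continuous_matrix fun i j => ?_
  simp only [hankelMatrix, Matrix.of_apply, coeffInt]
  split_ifs
  · exact continuous_taylorCoeff ζ _
  · exact continuous_const

theorem continuousAt_padeDenVec {p q : ℕ} {ζ : closure Ω} {f₀ : AInfty Ω}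
    (h : f₀.InPadeClass p q ζ) :
    ContinuousAt (fun f : AInfty Ω => padeDenVec (f.taylorCoeff ζ) p q) f₀ := by
  have h1 : ContinuousAt (fun f : AInfty Ω => (hankelMatrix (f.taylorCoeff ζ) p q)⁻¹) f₀ := by
    simp only [Matrix.inv_def, Ring.inverse_eq_inv']
    exact ((continuous_hankelMatrix p q ζ).matrix_det.continuousAt.inv₀ h).smul
      (continuous_hankelMatrix p q ζ).matrix_adjugate.continuousAt
  have h2 : Continuous (fun f : AInfty Ω => fun i : Fin q => -f.taylorCoeff ζ (p + 1 + i)) :=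
    continuous_pi fun i => (continuous_taylorCoeff ζ _).neg
  refine continuousAt_pi.2 fun i => ?_
  simp only [padeDenVec, Matrix.mulVec, dotProduct]
  refine tendsto_finsetSum _ fun j _ => ?_
  have h3 : Continuous fun M : Matrix (Fin q) (Fin q) ℂ => M i j := continuous_id.matrix_elem i j
  exact (h3.continuousAt.comp h1).mul ((continuous_apply j).comp h2).continuousAt

theorem eventually_inPadeClass {p q : ℕ} {ζ : closure Ω} {f₀ : AInfty Ω}
    (h : f₀.InPadeClass p q ζ) : ∀ᶠ f in 𝓝 f₀, f.InPadeClass p q ζ :=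
  (continuous_hankelMatrix p q ζ).matrix_det.continuousAt.eventually_ne h

/-- The formula for the coefficients holds only on the Padé class, which is a neighbourhood of `f₀`.
The degree bound holds for all `f`, thanks to the default value of `padePair`. -/
theorem continuousCoeffAt_padeDen {p q : ℕ} {ζ : closure Ω} {f₀ : AInfty Ω}
    (h : f₀.InPadeClass p q ζ) :
    ContinuousCoeffAt (fun f : AInfty Ω => (padePair (f.taylorCoeff ζ) p q).2) f₀ := by
  refine ⟨⟨q, fun f => padePair_den_natDegree_le _ _ _⟩, fun k => ?_⟩
  have hev : ∀ᶠ f : AInfty Ω in 𝓝 f₀, (if k = 0 then 1 else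
      if hk : q - k < q ∧ k ≤ q then padeDenVec (f.taylorCoeff ζ) p q ⟨q - k, hk.1⟩ else 0) =
      (padePair (f.taylorCoeff ζ) p q).2.coeff k := by
    filter_upwards [eventually_inPadeClass h] with f hf
    rw [(padePair_spec hf).den_coeff hf]
  refine ContinuousAt.congr ?_ hev
  split_ifs with h0 hk
  · exact continuousAt_const
  · exact (continuous_apply _).continuousAt.comp (continuousAt_padeDenVec h)
  · exact continuousAt_const

theorem continuousCoeffAt_padeNum {p q : ℕ} {ζ : closure Ω} {f₀ : AInfty Ω}
    (h : f₀.InPadeClass p q ζ) :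
    ContinuousCoeffAt (fun f : AInfty Ω => (padePair (f.taylorCoeff ζ) p q).1) f₀ := by
  refine ⟨⟨p, fun f => padePair_num_natDegree_le _ _ _⟩, fun k => ?_⟩
  have hev : ∀ᶠ f : AInfty Ω in 𝓝 f₀, (if k ≤ p then ∑ j ∈ Finset.range (q + 1),
      (padePair (f.taylorCoeff ζ) p q).2.coeff j * coeffInt (f.taylorCoeff ζ) ((k : ℤ) - j)
      else 0) = (padePair (f.taylorCoeff ζ) p q).1.coeff k := by
    filter_upwards [eventually_inPadeClass h] with f hf
    rw [(padePair_spec hf).num_coeff]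
  refine ContinuousAt.congr ?_ hev
  split_ifs
  · refine tendsto_finsetSum _ fun j _ => ?_
    refine ((continuousCoeffAt_padeDen h).2 j).mul ?_
    simp only [coeffInt]
    split_ifs
    · exact (continuous_taylorCoeff ζ _).continuousAt
    · exact continuousAt_const
  · exact continuousAt_const

/-- The functions in `D_{p,q}(ζ)` whose Padé approximant has no poles in the `n`-th compact part
of the closure of `Ω` and is there `1 / (n + 1)`-close to the function, together with the
derivatives up to order `n`. -/
def padeClose (Ω : Set ℂ) (ζ : closure Ω) (n : ℕ) (x : ℕ × ℕ) : Set (AInfty Ω) :=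
  {f | f.InPadeClass x.1 x.2 ζ ∧ ∀ z ∈ closurePart Ω n, f.padeDen x.1 x.2 ζ z ≠ 0 ∧
    ∀ l ≤ n, ‖iteratedDeriv l (f.pade x.1 x.2 ζ) z - f.extDeriv l z‖ < 1 / ((n : ℝ) + 1)}

/-- All conditions are inequalities `≠` or `<` between quantities jointly continuous at the relevant
pairs `(f₀, z)`; compactness of `closurePart Ω n` makes the neighbourhood of `f₀` uniform in `z`. -/
theorem isOpen_padeClose (ζ : closure Ω) (n : ℕ) (x : ℕ × ℕ) : IsOpen (padeClose Ω ζ n x) := by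
  obtain ⟨p, q⟩ := x
  rw [isOpen_iff_eventually]
  rintro f₀ ⟨h, hK⟩
  refine (eventually_inPadeClass h).and ?_
  refine (isCompact_closurePart Ω n).eventually_forall_of_forall_eventually fun z hz => ?_
  obtain ⟨hz, hl⟩ := hK z hz
  have hφ : Continuous fun z : closure Ω => (z : ℂ) - ζ := by fun_prop
  have hD := (continuousCoeffAt_padeDen h).continuousAt_eval hφ z
  have hne : ∀ᶠ y : AInfty Ω × closure Ω in 𝓝 (f₀, z), y.1.padeDen p q ζ y.2 ≠ 0 :=
    hD.eventually_ne hz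
  refine hne.and ((eventually_all_finite (Set.finite_Iic n)).2 fun l hln => ?_)
  have hc : ContinuousAt (fun y : AInfty Ω × closure Ω =>
      iteratedDeriv l (y.1.pade p q ζ) y.2) (f₀, z) := by
    have hN := ((continuousCoeffAt_padeNum h).quotientDerivNum
      (continuousCoeffAt_padeDen h) l).continuousAt_eval hφ z
    refine (hN.div (hD.pow (l + 1)) (pow_ne_zero _ hz)).congr ?_
    filter_upwards [hne] with y hy
    exact (iteratedDeriv_quotient _ _ _ l hy).symm
  exact (hc.sub (continuous_extDeriv_apply l).continuousAt).norm.eventually_lt_const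
    (hl l hln)

/-- The single parameter `n` bounds the compact set, the order of derivative and the error at once.
Conversely, any choice of one pair for each `n` is a suitable sequence. -/
theorem isApproximatedByPade_iff (F : Set (ℕ × ℕ)) (ζ : closure Ω) (f : AInfty Ω) :
    f.IsApproximatedByPade F ζ ↔ ∀ n, ∃ x ∈ F, f ∈ padeClose Ω ζ n x := by
  constructor
  · rintro ⟨p, q, hF, hcl, hK⟩ n
    obtain ⟨h1, h2⟩ := hK _ (isCompact_closurePart Ω n)
    have h3 : ∀ᶠ m in atTop, ∀ l ≤ n, ∀ z ∈ closurePart Ω n,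
        ‖iteratedDeriv l (f.pade (p m) (q m) ζ) z - f.extDeriv l z‖ < 1 / ((n : ℝ) + 1) := by
      refine (eventually_all_finite (Set.finite_Iic n)).2 fun l _ => ?_
      filter_upwards [Metric.tendstoUniformlyOn_iff.1 (h2 l) (1 / ((n : ℝ) + 1))
        (by positivity)] with m hm z hz
      rw [← dist_eq_norm, dist_comm]
      exact hm z hz
    obtain ⟨m, hm1, hm3⟩ := (h1.and h3).exists
    exact ⟨(p m, q m), hF m, hcl m, fun z hz => ⟨hm1 z hz, fun l hl => hm3 l hl z hz⟩⟩
  · intro h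
    choose x hxF hx using h
    refine ⟨fun n => (x n).1, fun n => (x n).2, hxF, fun n => (hx n).1, fun K hK => ?_⟩
    obtain ⟨m, hm⟩ := exists_subset_closurePart hK
    constructor
    · filter_upwards [eventually_ge_atTop m] with n hn z hz using ((hx n).2 z (hm n hn hz)).1
    · intro l
      rw [Metric.tendstoUniformlyOn_iff]
      intro ε hε
      filter_upwards [eventually_ge_atTop m, eventually_ge_atTop l,
        (tendsto_one_div_add_atTop_nhds_zero_nat (𝕜 := ℝ)).eventually_lt_const hε]
        with n h1 h2 h3 z hz
      rw [dist_comm, dist_eq_norm]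
      exact (((hx n).2 z (hm n h1 hz)).2 l h2).trans h3

theorem isGδ_isApproximatedByPade (F : Set (ℕ × ℕ)) (ζ : closure Ω) :
    IsGδ {f : AInfty Ω | f.IsApproximatedByPade F ζ} := by
  have : {f : AInfty Ω | f.IsApproximatedByPade F ζ} =
      ⋂ n : ℕ, ⋃ x ∈ F, padeClose Ω ζ n x := by
    ext f
    simp only [mem_ofPred_eq, isApproximatedByPade_iff, mem_iInter, mem_iUnion, exists_prop]
  rw [this]
  exact .iInter_of_isOpen fun n => isOpen_biUnion fun x _ => isOpen_padeClose ζ n x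

end AInfty

/-! ### A Cauchy formula with a smooth cutoff -/

theorem continuous_mul_of_tsupport_subset {u h : ℂ → ℂ} {U : Set ℂ} (hU : IsOpen U)
    (hu : Continuous u) (hsub : tsupport u ⊆ U) (hh : ContinuousOn h U) :
    Continuous fun w => u w * h w := by
  rw [continuous_iff_continuousAt]
  intro w
  by_cases hw : w ∈ tsupport u
  · exact hu.continuousAt.mul (hh.continuousAt (hU.mem_nhds (hsub hw)))
  · have h0 := notMem_tsupport_iff_eventuallyEq.1 hw
    refine (continuousAt_const (y := (0 : ℂ))).congr ?_
    filter_upwards [h0] with x hx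
    simp [hx]

open MeasureTheory in
theorem integrable_mul_of_tsupport_subset {u h : ℂ → ℂ} {U : Set ℂ} (hU : IsOpen U)
    (hu : Continuous u) (hc : HasCompactSupport u) (hsub : tsupport u ⊆ U)
    (hh : ContinuousOn h U) : Integrable fun w => u w * h w :=
  (continuous_mul_of_tsupport_subset hU hu hsub hh).integrable_of_hasCompactSupport
    (hc.mul_right (f' := h))

/-- Twice the Wirtinger derivative with respect to the conjugate variable. -/
def dbar (χ : ℂ → ℂ) (w : ℂ) : ℂ :=
  fderiv ℝ χ w 1 + Complex.I * fderiv ℝ χ w Complex.I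

theorem continuous_dbar {χ : ℂ → ℂ} (hχ : ContDiff ℝ 1 χ) : Continuous (dbar χ) := by
  have := hχ.continuous_fderiv one_ne_zero
  unfold dbar
  fun_prop

theorem tsupport_dbar_subset (χ : ℂ → ℂ) : tsupport (dbar χ) ⊆ tsupport χ := by
  refine closure_minimal (fun w hw => ?_) (isClosed_tsupport χ)
  by_contra h
  have h0 : χ =ᶠ[𝓝 w] 0 := notMem_tsupport_iff_eventuallyEq.1 h
  apply hw
  simp [dbar, h0.fderiv_eq]

theorem HasCompactSupport.dbar {χ : ℂ → ℂ} (hχ : HasCompactSupport χ) :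
    HasCompactSupport (dbar χ) :=
  hχ.mono' ((subset_tsupport _).trans (tsupport_dbar_subset χ))

theorem notMem_tsupport_dbar {χ : ℂ → ℂ} {z : ℂ} (h : ∀ᶠ w in 𝓝 z, χ w = 1) :
    z ∉ tsupport (dbar χ) := by
  rw [notMem_tsupport_iff_eventuallyEq]
  filter_upwards [h.eventually_nhds] with w hw
  have : χ =ᶠ[𝓝 w] fun _ => 1 := hw
  simp [dbar, this.fderiv_eq]

-- Integration by parts moves the derivatives onto `h`, where the Cauchy–Riemann equations
-- annihilate them.
open MeasureTheory in
theorem integral_dbar_mul_eq_zero {χ h : ℂ → ℂ} {U : Set ℂ} (hU : IsOpen U)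
    (hχ : ContDiff ℝ 1 χ) (hc : HasCompactSupport χ) (hsub : tsupport χ ⊆ U)
    (hh : DifferentiableOn ℂ h U) : ∫ w, dbar χ w * h w = 0 := by
  have hhd (w : ℂ) (hw : w ∈ U) (v : ℂ) : fderiv ℝ h w v = deriv h w * v := by
    have h1 := ((hh w hw).differentiableAt (hU.mem_nhds hw)).hasDerivAt.hasFDerivAt
    have h2 := h1.restrictScalars ℝ
    rw [h2.fderiv]
    simp [mul_comm]
  have hcont (v : ℂ) : ContinuousOn (fun w => fderiv ℝ h w v) U :=
    (((hh.deriv hU).continuousOn.mul continuousOn_const)).congr fun w hw => hhd w hw v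
  have hχ' (v : ℂ) : Continuous fun w => fderiv ℝ χ w v :=
    (hχ.continuous_fderiv one_ne_zero).clm_apply continuous_const
  have hc' (v : ℂ) : HasCompactSupport fun w => fderiv ℝ χ w v := hc.fderiv_apply ℝ v
  have hs' (v : ℂ) : tsupport (fun w => fderiv ℝ χ w v) ⊆ U :=
    (tsupport_fderiv_apply_subset ℝ v).trans hsub
  have i1 (v : ℂ) : Integrable fun w => fderiv ℝ χ w v * h w :=
    integrable_mul_of_tsupport_subset hU (hχ' v) (hc' v) (hs' v) hh.continuousOn
  have i2 (v : ℂ) : Integrable fun w => χ w * fderiv ℝ h w v :=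
    integrable_mul_of_tsupport_subset hU hχ.continuous hc hsub (hcont v)
  have i3 : Integrable fun w => χ w * h w :=
    integrable_mul_of_tsupport_subset hU hχ.continuous hc hsub hh.continuousOn
  have key (v : ℂ) := integral_mul_fderiv_eq_neg_fderiv_mul_of_integrable (i1 v) (i2 v) i3
    (fun w _ => (hχ.differentiable one_ne_zero) w)
    (fun w hw => ((hh w (hsub hw)).differentiableAt (hU.mem_nhds (hsub hw))).restrictScalars ℝ)
  have e : ∀ w, χ w * fderiv ℝ h w 1 + Complex.I * (χ w * fderiv ℝ h w Complex.I) = 0 := by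
    intro w
    by_cases hw : w ∈ tsupport χ
    · rw [hhd w (hsub hw), hhd w (hsub hw)]
      linear_combination (χ w * deriv h w) * Complex.I_mul_I
    · rw [image_eq_zero_of_notMem_tsupport hw]; simp
  have e2 : ∫ w, (χ w * fderiv ℝ h w 1 + Complex.I * (χ w * fderiv ℝ h w Complex.I)) = 0 := by
    simp [e]
  rw [integral_add (i2 1) ((i2 _).const_mul _), integral_const_mul, key, key] at e2
  have e3 : (fun w => dbar χ w * h w) = fun w =>
      fderiv ℝ χ w 1 * h w + Complex.I * (fderiv ℝ χ w Complex.I * h w) := by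
    ext w
    simp only [dbar]
    ring
  rw [e3, integral_add (i1 1) ((i1 _).const_mul _), integral_const_mul]
  linear_combination -e2

/-- A radial smooth bump function about the origin. -/
def radialBump (w : ℂ) : ℂ := (Real.smoothTransition (2 - ‖w‖ ^ 2) : ℂ)

theorem contDiff_radialBump : ContDiff ℝ 1 radialBump := by
  have h : ContDiff ℝ 1 fun w : ℂ => Real.smoothTransition (2 - ‖w‖ ^ 2) :=
    Real.smoothTransition.contDiff.comp (contDiff_const.sub (contDiff_norm_sq ℝ))
  exact Complex.ofRealCLM.contDiff.comp h

theorem radialBump_eventuallyEq_one : ∀ᶠ w in 𝓝 (0 : ℂ), radialBump w = 1 := by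
  filter_upwards [Metric.ball_mem_nhds (0 : ℂ) one_pos] with w hw
  have hw : ‖w‖ < 1 := by simpa using hw
  rw [radialBump, Real.smoothTransition.one_of_one_le (by nlinarith [norm_nonneg w])]
  simp

theorem hasCompactSupport_radialBump : HasCompactSupport radialBump := by
  refine HasCompactSupport.intro (isCompact_closedBall (0 : ℂ) 2) fun w hw => ?_
  have hw : 2 < ‖w‖ := by simpa using hw
  rw [radialBump, Real.smoothTransition.zero_of_nonpos (by nlinarith [norm_nonneg w])]
  simp

/-- The bump is taken radial for this: division by `w` leaves a real function of constant sign. -/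
theorem dbar_radialBump (w : ℂ) :
    dbar radialBump w = ((-2 * deriv Real.smoothTransition (2 - ‖w‖ ^ 2) : ℝ) : ℂ) * w := by
  have h1 : HasDerivAt Real.smoothTransition (deriv Real.smoothTransition (2 - ‖w‖ ^ 2))
      (2 - ‖w‖ ^ 2) :=
    ((Real.smoothTransition.contDiff (n := 1)).differentiable one_ne_zero _).hasDerivAt
  have h2 : HasFDerivAt (fun w : ℂ => 2 - ‖w‖ ^ 2) (-(2 • innerSL ℝ w)) w :=
    (hasStrictFDerivAt_norm_sq w).hasFDerivAt.const_sub 2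
  have h3 := Complex.ofRealCLM.hasFDerivAt.comp w (h1.comp_hasFDerivAt w h2)
  have h4 : HasFDerivAt radialBump _ w := h3
  rw [dbar, h4.fderiv]
  simp [Complex.inner]
  apply Complex.ext <;> simp <;> ring

open MeasureTheory in
/-- The value of all the integrals of `dbar χ / (w - z)`, where `χ` is a cutoff about `z`. -/
def cauchyKernelConst : ℂ := ∫ w : ℂ, dbar radialBump w * w⁻¹

-- The integrand is real, nowhere positive off the origin and not identically zero. The exact value
-- is never needed.
open MeasureTheory in
theorem cauchyKernelConst_ne_zero : cauchyKernelConst ≠ 0 := by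
  have hder : Continuous (deriv Real.smoothTransition) :=
    (Real.smoothTransition.contDiff (n := 1)).continuous_deriv le_rfl
  set s : ℂ → ℝ := fun w => deriv Real.smoothTransition (2 - ‖w‖ ^ 2) with hs
  have hsc : Continuous s := hder.comp (by fun_prop)
  have hcpt : HasCompactSupport s := by
    refine HasCompactSupport.intro (isCompact_closedBall (0 : ℂ) 2) fun w hw => ?_
    have hw : 2 < ‖w‖ := by simpa using hw
    have : Real.smoothTransition =ᶠ[𝓝 (2 - ‖w‖ ^ 2)] fun _ => 0 := by
      filter_upwards [Iio_mem_nhds (show 2 - ‖w‖ ^ 2 < 0 by nlinarith [norm_nonneg w])] with t ht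
      exact Real.smoothTransition.zero_of_nonpos (le_of_lt ht)
    simp [hs, this.deriv_eq]
  have hnn : 0 ≤ s := fun w => Real.smoothTransition.monotone.deriv_nonneg
  -- By the mean value theorem `smoothTransition` has slope `1` at some `t` in `(0, 1)`; the point
  -- with `‖w‖ ^ 2 = 2 - t` is where `s` does not vanish.
  obtain ⟨t, ⟨ht0, ht1⟩, ht⟩ := exists_deriv_eq_slope Real.smoothTransition one_pos
    Real.smoothTransition.continuous.continuousOn
    ((Real.smoothTransition.contDiff (n := 1)).differentiable one_ne_zero).differentiableOn
  have hne : s ((√(2 - t) : ℝ) : ℂ) ≠ 0 := by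
    simp only [hs, Complex.norm_real, Real.norm_eq_abs, sq_abs]
    rw [Real.sq_sqrt (by linarith), sub_sub_cancel, ht]
    simp
  have hpos : 0 < ∫ w, s w :=
    hsc.integral_pos_of_hasCompactSupport_nonneg_nonzero hcpt hnn hne
  have e : cauchyKernelConst = ((-2 * ∫ w, s w : ℝ) : ℂ) := by
    rw [cauchyKernelConst, ← integral_const_mul, ← integral_complex_ofReal]
    refine integral_congr_ae ?_
    filter_upwards [Measure.ae_ne volume (0 : ℂ)] with w hw
    rw [dbar_radialBump, mul_assoc, mul_inv_cancel₀ hw, mul_one]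
  rw [e]
  exact_mod_cast (by linarith : -2 * ∫ w, s w < 0).ne

-- Two cutoffs equal to `1` near `z` have a difference supported away from `z`, where the kernel is
-- holomorphic. So `χ` may be replaced by the translated radial bump.
open MeasureTheory in
theorem integral_dbar_mul_inv {χ : ℂ → ℂ} (hχ : ContDiff ℝ 1 χ) (hc : HasCompactSupport χ) {z : ℂ}
    (hz : ∀ᶠ w in 𝓝 z, χ w = 1) : ∫ w, dbar χ w * (w - z)⁻¹ = cauchyKernelConst := by
  set ρ : ℂ → ℂ := fun w => radialBump (w - z) with hρdef
  have hρ : ContDiff ℝ 1 ρ := contDiff_radialBump.comp (contDiff_id.sub contDiff_const)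
  have hρc : HasCompactSupport ρ :=
    hasCompactSupport_radialBump.comp_homeomorph (Homeomorph.subRight z)
  have hρz : ∀ᶠ w in 𝓝 z, ρ w = 1 := by
    have : Tendsto (fun w => w - z) (𝓝 z) (𝓝 0) := by
      have : Continuous fun w => w - z := by fun_prop
      simpa using this.tendsto z
    exact this.eventually radialBump_eventuallyEq_one
  have hopen : IsOpen ({z}ᶜ : Set ℂ) := isOpen_compl_singleton
  have hinv : DifferentiableOn ℂ (fun w => (w - z)⁻¹) {z}ᶜ := by
    intro w hw
    exact ((differentiableAt_id.sub_const z).inv (sub_ne_zero.2 hw)).differentiableWithinAt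
  have h0 : ∫ w, dbar (χ - ρ) w * (w - z)⁻¹ = 0 := by
    refine integral_dbar_mul_eq_zero hopen (hχ.sub hρ) (hc.sub hρc) ?_ hinv
    rw [subset_compl_singleton_iff, notMem_tsupport_iff_eventuallyEq]
    filter_upwards [hz, hρz] with w h1 h2
    simp [h1, h2]
  have hsub : ∀ w, dbar (χ - ρ) w = dbar χ w - dbar ρ w := by
    intro w
    simp only [dbar]
    rw [fderiv_sub (hχ.differentiable one_ne_zero w) (hρ.differentiable one_ne_zero w)]
    simp only [_root_.sub_apply]
    ring
  have i1 : Integrable fun w => dbar χ w * (w - z)⁻¹ :=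
    integrable_mul_of_tsupport_subset hopen (continuous_dbar hχ) hc.dbar
      (subset_compl_singleton_iff.2 (notMem_tsupport_dbar hz)) hinv.continuousOn
  have i2 : Integrable fun w => dbar ρ w * (w - z)⁻¹ :=
    integrable_mul_of_tsupport_subset hopen (continuous_dbar hρ) hρc.dbar
      (subset_compl_singleton_iff.2 (notMem_tsupport_dbar hρz)) hinv.continuousOn
  simp only [hsub, sub_mul] at h0
  rw [integral_sub i1 i2, sub_eq_zero] at h0
  rw [h0, cauchyKernelConst, ← integral_sub_right_eq_self (fun w => dbar radialBump w * w⁻¹) z]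
  congr 1
  ext w
  simp [dbar, hρdef, fderiv_comp_sub]

open MeasureTheory in
/-- A Cauchy formula with a smooth cutoff function. -/
theorem integral_dbar_mul_cauchyKernel {χ g : ℂ → ℂ} {U : Set ℂ} (hU : IsOpen U)
    (hχ : ContDiff ℝ 1 χ) (hc : HasCompactSupport χ) (hsub : tsupport χ ⊆ U)
    (hg : DifferentiableOn ℂ g U) {z : ℂ} (hzU : z ∈ U) (hz : ∀ᶠ w in 𝓝 z, χ w = 1) :
    ∫ w, dbar χ w * g w * (w - z)⁻¹ = cauchyKernelConst * g z := by
  -- The difference quotient is holomorphic across `z`, so its integral vanishes. It splits into the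
  -- wanted integral and `g z` times the constant; at `w = z` the factor `dbar χ` is zero.
  have hd : DifferentiableOn ℂ (dslope g z) U :=
    (Complex.differentiableOn_dslope (hU.mem_nhds hzU)).2 hg
  have h0 := integral_dbar_mul_eq_zero hU hχ hc hsub hd
  have hzs := notMem_tsupport_dbar hz
  have hinv : ContinuousOn (fun w : ℂ => (w - z)⁻¹) {z}ᶜ := fun w hw =>
    ((continuous_id.sub continuous_const).continuousAt.inv₀ (sub_ne_zero.2 hw)).continuousWithinAt
  have i1 : Integrable fun w => dbar χ w * (w - z)⁻¹ :=
    integrable_mul_of_tsupport_subset isOpen_compl_singleton (continuous_dbar hχ) hc.dbar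
      (subset_compl_singleton_iff.2 hzs) hinv
  have i2 : Integrable fun w => dbar χ w * (g w * (w - z)⁻¹) :=
    integrable_mul_of_tsupport_subset (hU.inter isOpen_compl_singleton) (continuous_dbar hχ)
      hc.dbar (subset_inter ((tsupport_dbar_subset χ).trans hsub)
        (subset_compl_singleton_iff.2 hzs))
      ((hg.continuousOn.mono inter_subset_left).mul (hinv.mono inter_subset_right))
  have e : ∀ w, dbar χ w * dslope g z w =
      dbar χ w * (g w * (w - z)⁻¹) - g z * (dbar χ w * (w - z)⁻¹) := by
    intro w
    rcases eq_or_ne w z with rfl | hw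
    · simp [image_eq_zero_of_notMem_tsupport hzs]
    · rw [dslope_of_ne _ hw, slope_def_field]
      ring
  simp only [e] at h0
  rw [integral_sub i2 (i1.const_mul _), integral_const_mul, integral_dbar_mul_inv hχ hc hz] at h0
  simp only [mul_assoc]
  linear_combination h0

open scoped Manifold in
theorem exists_smooth_cutoff {K U : Set ℂ} (hK : IsCompact K) (hU : IsOpen U) (hKU : K ⊆ U) :
    ∃ χ : ℂ → ℂ, ContDiff ℝ 1 χ ∧ HasCompactSupport χ ∧ tsupport χ ⊆ U ∧
      ∀ z ∈ K, ∀ᶠ w in 𝓝 z, χ w = 1 := by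
  obtain ⟨T, hT, hKT, hTU⟩ := exists_compact_between hK hU hKU
  obtain ⟨f, h1, h0, -⟩ := exists_contMDiffMap_one_nhds_of_subset_interior (n := 1) 𝓘(ℝ, ℂ)
    hK.isClosed hKT
  have hs : tsupport (fun w => (f w : ℂ)) ⊆ T := by
    refine closure_minimal (fun w hw => ?_) hT.isClosed
    by_contra h
    exact hw (by simp [h0 w h])
  refine ⟨fun w => f w, Complex.ofRealCLM.contDiff.comp f.contMDiff.contDiff,
    hT.of_isClosed_subset (isClosed_tsupport _) hs, hs.trans hTU, fun z hz => ?_⟩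
  filter_upwards [eventually_nhdsSet_iff_forall.1 h1 z hz] with w hw
  simp [hw]

/-! ### Runge's theorem, with derivatives -/

/-- The restrictions to `K` of the rational functions without poles in `K`. -/
def rationalFunctionsOn (K : Set ℂ) : Submodule ℂ C(K, ℂ) where
  carrier := {φ | ∃ N D : ℂ[X], D ≠ 0 ∧ ∀ z : K, D.eval (z : ℂ) ≠ 0 ∧
    φ z = N.eval (z : ℂ) / D.eval (z : ℂ)}
  zero_mem' := ⟨0, 1, one_ne_zero, by simp⟩
  add_mem' := by
    rintro φ ψ ⟨N, D, hD, h⟩ ⟨M, E, hE, h'⟩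
    refine ⟨N * E + M * D, D * E, mul_ne_zero hD hE, fun z => ?_⟩
    obtain ⟨h1, h2⟩ := h z
    obtain ⟨h3, h4⟩ := h' z
    rw [eval_mul]
    refine ⟨mul_ne_zero h1 h3, ?_⟩
    rw [ContinuousMap.add_apply, h2, h4, eval_add, eval_mul, eval_mul]
    field_simp
  smul_mem' := by
    rintro c φ ⟨N, D, hD, h⟩
    refine ⟨C c * N, D, hD, fun z => ⟨(h z).1, ?_⟩⟩
    rw [ContinuousMap.smul_apply, (h z).2, eval_mul, eval_C, smul_eq_mul]
    ring

open MeasureTheory in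
/-- Runge's theorem. -/
theorem exists_rational_approx {K U : Set ℂ} (hK : IsCompact K) (hU : IsOpen U) (hKU : K ⊆ U)
    {g : ℂ → ℂ} (hg : DifferentiableOn ℂ g U) {ε : ℝ} (hε : 0 < ε) :
    ∃ N D : ℂ[X], D ≠ 0 ∧ ∀ z ∈ K, D.eval z ≠ 0 ∧ ‖N.eval z / D.eval z - g z‖ < ε := by
  obtain ⟨χ, hχ, hc, hsub, h1⟩ := exists_smooth_cutoff hK hU hKU
  have : CompactSpace K := isCompact_iff_compactSpace.1 hK
  set m : ℂ → ℂ := fun w => dbar χ w * g w with hm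
  have hmc : Continuous m := continuous_mul_of_tsupport_subset hU (continuous_dbar hχ)
    ((tsupport_dbar_subset χ).trans hsub) hg.continuousOn
  have hmcpt : HasCompactSupport m := hc.dbar.mul_right
  have hmK : ∀ z ∈ K, ∀ᶠ w in 𝓝 z, m w = 0 := by
    intro z hz
    filter_upwards [notMem_tsupport_iff_eventuallyEq.1 (notMem_tsupport_dbar (h1 z hz))] with w hw
    simp [hm, hw]
  -- The kernel is singular only for `w = z` in `K`, but `m` vanishes near every point of `K`.
  have hjoint : Continuous fun x : ℂ × K => m x.1 * (x.1 - x.2)⁻¹ := by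
    rw [continuous_iff_continuousAt]
    rintro ⟨w, z⟩
    by_cases hw : w ∈ K
    · refine (continuousAt_const (y := (0 : ℂ))).congr ?_
      filter_upwards [continuousAt_fst.eventually (hmK w hw)] with x hx
      simp [hx]
    · have hne : w - z ≠ 0 := sub_ne_zero.2 fun h => hw (h ▸ z.2)
      have hcont : Continuous fun x : ℂ × K => x.1 - (x.2 : ℂ) := by fun_prop
      exact (hmc.comp continuous_fst).continuousAt.mul (hcont.continuousAt.inv₀ hne)
  -- The Cauchy formula becomes an integral with values in `C(K, ℂ)`, each value of the integrand
  -- being a rational function with at most the pole `w`, off `K`.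
  set Φ : C(ℂ, C(K, ℂ)) := ContinuousMap.curry ⟨_, hjoint⟩ with hΦ
  have hΦa (w : ℂ) (z : K) : Φ w z = m w * (w - z)⁻¹ := rfl
  have hΦ0 (w : ℂ) (hw : m w = 0) : Φ w = 0 := by
    ext z
    simp [hΦa, hw]
  set T := (rationalFunctionsOn K).topologicalClosure with hT
  have hΦT (w : ℂ) : Φ w ∈ T := by
    by_cases hw : w ∈ K
    · rw [hΦ0 w (hmK w hw).self_of_nhds]
      exact T.zero_mem
    · refine Submodule.le_topologicalClosure _ ⟨C (m w), C w - X, ?_, fun z => ⟨?_, ?_⟩⟩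
      · intro h
        have := congrArg (fun P => P.coeff 1) h
        simp [coeff_X] at this
      · have hne : w ≠ z := fun h => hw (h ▸ z.2)
        simpa using sub_ne_zero.2 hne
      · simp [hΦa, div_eq_mul_inv]
  -- Integrating inside the closed, hence complete, subspace `T` shows that the integral stays in
  -- the closure of the rational functions.
  set Ψ : ℂ → T := fun w => ⟨Φ w, hΦT w⟩ with hΨ
  have hΨc : Continuous Ψ := Φ.continuous.subtype_mk _
  have hΨcpt : HasCompactSupport Ψ := by
    refine hmcpt.mono fun w hw => ?_
    contrapose! hw
    have : m w = 0 := by simpa using hw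
    simp [hΨ, hΦ0 w this]
  have : CompleteSpace T := (Submodule.isClosed_topologicalClosure _).completeSpace_coe
  have hΨi : Integrable Ψ := hΨc.integrable_of_hasCompactSupport hΨcpt
  have hΦi : Integrable Φ := T.subtypeL.integrable_comp hΨi
  have hmem : ∫ w, Φ w ∈ T := by
    have := T.subtypeL.integral_comp_comm hΨi
    change ∫ w, Φ w = _ at this
    rw [this]
    exact (∫ w, Ψ w).2
  have hmem' : cauchyKernelConst⁻¹ • ∫ w, Φ w ∈ T := T.smul_mem _ hmem
  have hval (z : K) : (cauchyKernelConst⁻¹ • ∫ w, Φ w) z = g z := by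
    rw [ContinuousMap.smul_apply, ContinuousMap.integral_apply hΦi]
    simp only [hΦa, hm]
    rw [integral_dbar_mul_cauchyKernel hU hχ hc hsub hg (hKU z.2) (h1 z z.2), smul_eq_mul,
      inv_mul_cancel_left₀ cauchyKernelConst_ne_zero]
  obtain ⟨φ, ⟨N, D, hD, hND⟩, hφ⟩ := Metric.mem_closure_iff.1 hmem' ε hε
  refine ⟨N, D, hD, fun z hz => ⟨(hND ⟨z, hz⟩).1, ?_⟩⟩
  have h2 := (ContinuousMap.dist_apply_le_dist (⟨z, hz⟩ : K)).trans_lt hφ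
  rw [dist_comm, dist_eq_norm, hval, (hND ⟨z, hz⟩).2] at h2
  exact h2

theorem TendstoLocallyUniformlyOn.iteratedDeriv {ι : Type*} {φ : Filter ι} {V : Set ℂ}
    {R : ι → ℂ → ℂ} {g : ℂ → ℂ} (h : TendstoLocallyUniformlyOn R g φ V)
    (hR : ∀ i, DifferentiableOn ℂ (R i) V) (hV : IsOpen V) (l : ℕ) :
    TendstoLocallyUniformlyOn (fun i => _root_.iteratedDeriv l (R i)) (_root_.iteratedDeriv l g)
      φ V := by
  induction l with
  | zero => simpa using h
  | succ l ih =>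
    simp only [iteratedDeriv_succ]
    exact ih.deriv (Eventually.of_forall fun i => (hR i).iteratedDeriv_of_isOpen hV l) hV

/-- Locally uniform approximation of holomorphic functions entails that of the derivatives. -/
theorem exists_iteratedDeriv_lt {V K : Set ℂ} (hV : IsOpen V) (hK : IsCompact K) (hKV : K ⊆ V)
    {R : ℕ → ℂ → ℂ} {g : ℂ → ℂ} (h : TendstoLocallyUniformlyOn R g atTop V)
    (hR : ∀ i, DifferentiableOn ℂ (R i) V) (L : ℕ) {ε : ℝ} (hε : 0 < ε) :
    ∃ i, ∀ l ≤ L, ∀ z ∈ K, ‖iteratedDeriv l (R i) z - iteratedDeriv l g z‖ < ε := by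
  have : ∀ᶠ i in atTop, ∀ l ≤ L, ∀ z ∈ K,
      ‖iteratedDeriv l (R i) z - iteratedDeriv l g z‖ < ε := by
    refine (eventually_all_finite (Set.finite_Iic L)).2 fun l _ => ?_
    have h1 := (tendstoLocallyUniformlyOn_iff_forall_isCompact hV).1 (h.iteratedDeriv hR hV l)
      K hKV hK
    filter_upwards [Metric.tendstoUniformlyOn_iff.1 h1 ε hε] with i hi z hz
    rw [← dist_eq_norm, dist_comm]
    exact hi z hz
  exact this.exists

theorem differentiableOn_polynomial_div (N D : ℂ[X]) {V : Set ℂ} (h : ∀ z ∈ V, D.eval z ≠ 0) :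
    DifferentiableOn ℂ (fun z => N.eval z / D.eval z) V :=
  N.differentiable.differentiableOn.fun_div D.differentiable.differentiableOn h

/-- Runge's theorem for finitely many derivatives. -/
theorem exists_rational_approx_iteratedDeriv {K U : Set ℂ} (hK : IsCompact K) (hU : IsOpen U)
    (hKU : K ⊆ U) {g : ℂ → ℂ} (hg : DifferentiableOn ℂ g U) (L : ℕ) {ε : ℝ} (hε : 0 < ε) :
    ∃ N D : ℂ[X], D ≠ 0 ∧ (∀ z ∈ K, D.eval z ≠ 0) ∧ ∀ l ≤ L, ∀ z ∈ K,
      ‖iteratedDeriv l (fun z => N.eval z / D.eval z) z - iteratedDeriv l g z‖ < ε := by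
  -- Convergence of derivatives on `K` requires convergence on a neighbourhood of `K`, so Runge's
  -- theorem is applied on a larger compact set.
  obtain ⟨T, hT, hKT, hTU⟩ := exists_compact_between hK hU hKU
  choose N D hD hND using fun i : ℕ =>
    exists_rational_approx hT hU hTU hg (ε := 1 / ((i : ℝ) + 1)) (by positivity)
  have hunif : TendstoUniformlyOn (fun i z => (N i).eval z / (D i).eval z) g atTop T := by
    rw [Metric.tendstoUniformlyOn_iff]
    intro ε hε
    filter_upwards [(tendsto_one_div_add_atTop_nhds_zero_nat (𝕜 := ℝ)).eventually_lt_const hε]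
      with i hi z hz
    rw [dist_comm, dist_eq_norm]
    exact (hND i z hz).2.trans hi
  obtain ⟨i, hi⟩ := exists_iteratedDeriv_lt isOpen_interior hK hKT
    (hunif.mono interior_subset).tendstoLocallyUniformlyOn
    (fun i => differentiableOn_polynomial_div _ _ fun z hz => (hND i z (interior_subset hz)).1)
    L hε
  exact ⟨N i, D i, hD i, fun z hz => (hND i z (interior_subset (hKT hz))).1, hi⟩

/-- Polynomial approximation on closed discs. -/
theorem exists_polynomial_approx_iteratedDeriv {V : Set ℂ} {m : ℝ} (hm : 0 ≤ m) (hV : IsOpen V)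
    (hmV : Metric.closedBall 0 m ⊆ V) {g : ℂ → ℂ} (hg : DifferentiableOn ℂ g V) (L : ℕ) {ε : ℝ}
    (hε : 0 < ε) :
    ∃ P : ℂ[X], ∀ l ≤ L, ∀ z ∈ Metric.closedBall (0 : ℂ) m,
      ‖iteratedDeriv l (fun z => P.eval z) z - iteratedDeriv l g z‖ < ε := by
  obtain ⟨δ, hδ, hδV⟩ := (isCompact_closedBall (0 : ℂ) m).exists_cthickening_subset_open hV hmV
  rw [cthickening_closedBall hδ.le hm] at hδV
  -- The Taylor series is taken on the larger radius `δ + m`, positive even if `m = 0`, so that the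
  -- closed disc lies in the open disc of convergence.
  set r : NNReal := ⟨δ + m, by positivity⟩ with hr
  have hr' : (r : ℝ) = δ + m := rfl
  have hps := (hg.mono (hr' ▸ hδV)).hasFPowerSeriesOnBall (R := r)
    (by rw [← NNReal.coe_pos, hr']; positivity)
  have htl := hps.tendstoLocallyUniformlyOn
  simp only [zero_add] at htl
  rw [Metric.eball_coe] at htl
  set p := cauchyPowerSeries g 0 r
  have hP (n : ℕ) : (fun z => p.partialSum n z) =
      fun z => (∑ k ∈ Finset.range n, C (p.coeff k) * X ^ k : ℂ[X]).eval z := by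
    ext z
    simp only [FormalMultilinearSeries.partialSum,
      FormalMultilinearSeries.apply_eq_pow_smul_coeff, smul_eq_mul, eval_finsetSum, eval_mul,
      eval_C, eval_pow, eval_X]
    exact Finset.sum_congr rfl fun k _ => mul_comm _ _
  simp only [hP] at htl
  obtain ⟨n, hn⟩ := exists_iteratedDeriv_lt Metric.isOpen_ball (isCompact_closedBall (0 : ℂ) m)
    (Metric.closedBall_subset_ball (by rw [hr']; linarith)) htl
    (fun i => (Polynomial.differentiable _).differentiableOn) L hε
  exact ⟨_, hn⟩

/-! ### Removing poles and normalising fractions -/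

theorem exists_factorization_by_roots {D : ℂ[X]} (hD : D ≠ 0) (B : Set ℂ) :
    ∃ D₁ D₂ : ℂ[X], D = D₁ * D₂ ∧ (∀ z, D₁.eval z = 0 → z ∈ B) ∧ ∀ z ∈ B, D₂.eval z ≠ 0 := by
  classical
  refine ⟨((D.roots.filter (· ∈ B)).map fun a => X - C a).prod,
    C D.leadingCoeff * ((D.roots.filter (¬ · ∈ B)).map fun a => X - C a).prod, ?_, ?_, ?_⟩
  · rw [mul_left_comm, ← Multiset.prod_add, ← Multiset.map_add, Multiset.filter_add_not]
    exact (IsAlgClosed.splits D).eq_prod_roots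
  · intro z hz
    rw [eval_multiset_prod, Multiset.prod_eq_zero_iff] at hz
    simp only [Multiset.map_map, Multiset.mem_map, Multiset.mem_filter, Function.comp_apply,
      eval_sub, eval_X, eval_C] at hz
    obtain ⟨a, ⟨-, ha⟩, h⟩ := hz
    rwa [sub_eq_zero.1 h]
  · intro z hz h
    rw [eval_mul, eval_C, mul_eq_zero, or_iff_right (leadingCoeff_ne_zero.2 hD),
      eval_multiset_prod, Multiset.prod_eq_zero_iff] at h
    simp only [Multiset.map_map, Multiset.mem_map, Multiset.mem_filter, Function.comp_apply,
      eval_sub, eval_X, eval_C] at h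
    obtain ⟨a, ⟨-, ha⟩, h⟩ := h
    exact ha (sub_eq_zero.1 h ▸ hz)

theorem isCoprime_of_forall_eval {P Q : ℂ[X]} (h : ∀ z, P.eval z = 0 → Q.eval z ≠ 0) :
    IsCoprime P Q := by
  rw [Polynomial.isCoprime_iff_aeval_ne_zero_of_isAlgClosed ℂ ℂ]
  intro a
  by_cases ha : P.eval a = 0
  · exact Or.inr (by simpa using h a ha)
  · exact Or.inl (by simpa using ha)

/-- A rational function without poles in the part of `S` in a closed disc is approximated there,
with finitely many derivatives, by rational functions without poles in `S`. -/
theorem exists_rational_approx_push_poles {S : Set ℂ} {m : ℝ} (hm : 0 ≤ m)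
    {N D : ℂ[X]} (hD0 : D ≠ 0) (hD : ∀ z ∈ S ∩ Metric.closedBall 0 m, D.eval z ≠ 0) (L : ℕ) {ε : ℝ}
    (hε : 0 < ε) :
    ∃ A B : ℂ[X], (∀ z ∈ S, B.eval z ≠ 0) ∧ ∀ l ≤ L, ∀ z ∈ S ∩ Metric.closedBall (0 : ℂ) m,
      ‖iteratedDeriv l (fun z => A.eval z / B.eval z) z -
        iteratedDeriv l (fun z => N.eval z / D.eval z) z‖ < ε := by
  obtain ⟨D₁, D₂, rfl, h1, h2⟩ := exists_factorization_by_roots hD0 (Metric.closedBall (0 : ℂ) m)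
  -- From `u D₁ + v D₂ = 1` comes `N / (D₁ D₂) = N u / D₂ + N v / D₁`. The first summand is
  -- holomorphic near the disc and is replaced by a polynomial; the second has poles only at roots
  -- of `D₁`, which lie in the disc and therefore off `S`.
  obtain ⟨u, v, huv⟩ := isCoprime_of_forall_eval fun z hz => h2 z (h1 z hz)
  have hS : ∀ z ∈ S, D₁.eval z ≠ 0 := by
    intro z hz h
    exact hD z ⟨hz, h1 z h⟩ (by simp [h])
  have hV : IsOpen {z : ℂ | D₂.eval z ≠ 0} := isOpen_ne_fun D₂.continuous continuous_const
  have hdiff : DifferentiableOn ℂ (fun z => (N * u).eval z / D₂.eval z) {z : ℂ | D₂.eval z ≠ 0} :=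
    differentiableOn_polynomial_div _ _ fun z hz => hz
  obtain ⟨P, hP⟩ := exists_polynomial_approx_iteratedDeriv hm hV h2 hdiff L hε
  refine ⟨P * D₁ + N * v, D₁, hS, fun l hl z hz => ?_⟩
  have hz1 : D₁.eval z ≠ 0 := hS z hz.1
  have hz2 : D₂.eval z ≠ 0 := h2 z hz.2
  have e1 : ∀ᶠ w in 𝓝 z, D₁.eval w ≠ 0 := D₁.continuous.continuousAt.eventually_ne hz1
  have e2 : ∀ᶠ w in 𝓝 z, D₂.eval w ≠ 0 := D₂.continuous.continuousAt.eventually_ne hz2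
  set T : ℂ → ℂ := fun w => (N * v).eval w / D₁.eval w with hT
  have hTc : ContDiffAt ℂ l T z :=
    ((differentiableOn_polynomial_div (N * v) D₁ (V := {w | D₁.eval w ≠ 0})
      fun w hw => hw).analyticAt e1).contDiffAt
  have hQc : ContDiffAt ℂ l (fun z => (N * u).eval z / D₂.eval z) z :=
    (hdiff.analyticAt e2).contDiffAt
  have hPc : ContDiffAt ℂ l (fun z => P.eval z) z := P.differentiable.contDiff.contDiffAt
  have f1 : (fun w => (P * D₁ + N * v).eval w / D₁.eval w) =ᶠ[𝓝 z]
      (fun w => P.eval w) + T := by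
    filter_upwards [e1] with w hw
    simp only [hT, Pi.add_apply, eval_add, eval_mul]
    field_simp
  have f2 : (fun w => N.eval w / (D₁ * D₂).eval w) =ᶠ[𝓝 z]
      (fun w => (N * u).eval w / D₂.eval w) + T := by
    filter_upwards [e1, e2] with w hw hw2
    have := congrArg (eval w) huv
    simp only [eval_add, eval_mul, eval_one] at this
    simp only [hT, Pi.add_apply, eval_mul]
    field_simp
    linear_combination -N.eval w * this
  rw [f1.iteratedDeriv_eq, f2.iteratedDeriv_eq, iteratedDeriv_add hPc hTc,
    iteratedDeriv_add hQc hTc, add_sub_add_right_eq_sub]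
  exact hP l hl z hz.2

/-- An irreducible form of a rational function, in the local variable at a point that is not a
pole. -/
theorem exists_coprime_local_form (A B : ℂ[X]) {ζ : ℂ} (hζ : B.eval ζ ≠ 0) :
    ∃ N D : ℂ[X], IsCoprime N D ∧ D.coeff 0 = 1 ∧ ∀ z, B.eval z ≠ 0 →
      D.eval (z - ζ) ≠ 0 ∧ N.eval (z - ζ) / D.eval (z - ζ) = A.eval z / B.eval z := by
  have hB : B ≠ 0 := by
    rintro rfl
    simp at hζ
  obtain ⟨A', hA'⟩ := EuclideanDomain.gcd_dvd_left A B
  obtain ⟨B', hB'⟩ := EuclideanDomain.gcd_dvd_right A B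
  set G := EuclideanDomain.gcd A B
  have hG : G ≠ 0 := by
    intro h
    rw [h, zero_mul] at hB'
    exact hB hB'
  have hcop : IsCoprime A' B' := by
    obtain ⟨u, v, huv⟩ : ∃ u v, u * A + v * B = G :=
      ⟨EuclideanDomain.gcdA A B, EuclideanDomain.gcdB A B, by
        rw [mul_comm, mul_comm _ B]; exact (EuclideanDomain.gcd_eq_gcd_ab A B).symm⟩
    refine ⟨u, v, mul_left_cancel₀ hG ?_⟩
    linear_combination huv - u * hA' - v * hB'
  have hBe (z : ℂ) : B.eval z = G.eval z * B'.eval z := by rw [hB', eval_mul]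
  have hAe (z : ℂ) : A.eval z = G.eval z * A'.eval z := by rw [hA', eval_mul]
  have hne (z : ℂ) (hz : B.eval z ≠ 0) : G.eval z ≠ 0 ∧ B'.eval z ≠ 0 := by
    rw [hBe] at hz
    exact mul_ne_zero_iff.1 hz
  have hc := (hne ζ hζ).2
  have hu : IsUnit (C (B'.eval ζ)⁻¹) := isUnit_C.2 (inv_ne_zero hc).isUnit
  refine ⟨C (B'.eval ζ)⁻¹ * A'.comp (X + C ζ), C (B'.eval ζ)⁻¹ * B'.comp (X + C ζ), ?_, ?_, ?_⟩
  · rw [isCoprime_mul_unit_left hu]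
    exact hcop.map (compRingHom (X + C ζ))
  · rw [coeff_zero_eq_eval_zero]
    simp [hc]
  · intro z hz
    obtain ⟨h1, h2⟩ := hne z hz
    simp only [eval_mul, eval_C, eval_comp, eval_add, eval_X, sub_add_cancel]
    refine ⟨mul_ne_zero (inv_ne_zero hc) h2, ?_⟩
    rw [hAe, hBe]
    field_simp

/-! ### Inclusion in `X^∞` and density -/

namespace AInfty

variable {Ω : Set ℂ}

/-- Irreducible fractions whose numerator has the degree allowed by a pair of `F` coincide with
their Padé approximant. -/
theorem isApproximatedByPade_of_rational (hΩ : IsOpen Ω) {F : Set (ℕ × ℕ)} {ζ : closure Ω}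
    {p q : ℕ} (hpq : (p, q) ∈ F) {N D : ℂ[X]} (hN : N.natDegree = p) (hp : 0 < p)
    (hD : D.natDegree ≤ q) (hND : IsCoprime N D) (hD0 : D.coeff 0 = 1)
    (hDΩ : ∀ z ∈ closure Ω, D.eval (z - ζ) ≠ 0) {f : AInfty Ω}
    (hf : ∀ z : Ω, f.toFun z = N.eval ((z : ℂ) - ζ) / D.eval ((z : ℂ) - ζ)) :
    f.IsApproximatedByPade F ζ := by
  set r : ℂ → ℂ := fun z => N.eval (z - ζ) / D.eval (z - ζ) with hr
  have hV : IsOpen {z : ℂ | D.eval (z - ζ) ≠ 0} :=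
    isOpen_ne_fun (D.continuous.comp (continuous_id.sub continuous_const)) continuous_const
  have hdr : DifferentiableOn ℂ r {z : ℂ | D.eval (z - ζ) ≠ 0} := by
    refine DifferentiableOn.fun_div (Differentiable.differentiableOn ?_)
      (Differentiable.differentiableOn ?_) fun z hz => hz
    · exact N.differentiable.comp (differentiable_id.sub_const _)
    · exact D.differentiable.comp (differentiable_id.sub_const _)
  have hext (l : ℕ) (z : closure Ω) : f.extDeriv l z = iteratedDeriv l r z :=
    extDeriv_eq_iteratedDeriv hΩ hV hDΩ hdr hf l z
  have htaylor : (D : PowerSeries ℂ) * PowerSeries.mk (f.taylorCoeff ζ) = N := by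
    have e : f.taylorCoeff ζ = fun v => iteratedDeriv v r ζ / (v.factorial : ℂ) := by
      ext v
      rw [taylorCoeff, hext]
    rw [e]
    refine polynomial_mul_taylorSeries (hdr.analyticAt (hV.mem_nhds (hDΩ ζ ζ.2))) ?_
    filter_upwards [hV.mem_nhds (hDΩ ζ ζ.2)] with z hz
    exact mul_div_cancel₀ _ hz
  have hdet : f.InPadeClass p q ζ := hankelMatrix_det_ne_zero hN hp hD hND htaylor
  have hpair : padePair (f.taylorCoeff ζ) p q = (N, D) := by
    refine IsPadeApproximant.padePair_eq (isPadeApproximant_iff.2 ⟨hN.le, hD, hD0, ?_⟩) hdet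
    intro v _
    rw [htaylor, Polynomial.coeff_coe]
  have hden (z : ℂ) : f.padeDen p q ζ z = D.eval (z - ζ) := by rw [padeDen, hpair]
  have hpade : f.pade p q ζ = r := by
    ext z
    rw [pade, padeNum, hden, hpair]
  rw [isApproximatedByPade_iff]
  -- The same pair serves for every `n`, with error zero on the whole closure.
  refine fun n => ⟨(p, q), hpq, hdet, fun z _ => ⟨?_, fun l _ => ?_⟩⟩
  · rw [hden]
    exact hDΩ z z.2
  · rw [hpade, hext, sub_self, norm_zero]
    positivity

/-- An approximant close to `f` on a compact part may still have poles elsewhere in the closure of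
`Ω`; these are removed at the cost of a second error `ε / 2`. -/
theorem mem_XInfty_of_isApproximatedByPade (hΩ : IsOpen Ω) {F : Set (ℕ × ℕ)} {ζ : closure Ω}
    {f : AInfty Ω} (hf : f.IsApproximatedByPade F ζ) : f ∈ XInfty Ω := by
  refine mem_closure_of_approx fun n ε hε => ?_
  obtain ⟨m, hm, hnm⟩ := (((tendsto_one_div_add_atTop_nhds_zero_nat (𝕜 := ℝ)).eventually_lt_const
    (half_pos hε)).and (eventually_ge_atTop n)).exists
  obtain ⟨⟨p, q⟩, -, -, hK⟩ := (isApproximatedByPade_iff F ζ f).1 hf m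
  set N := (padePair (f.taylorCoeff ζ) p q).1.comp (X - C (ζ : ℂ)) with hN
  set D := (padePair (f.taylorCoeff ζ) p q).2.comp (X - C (ζ : ℂ)) with hD
  have hDe (z : ℂ) : D.eval z = f.padeDen p q ζ z := by simp [hD, padeDen]
  have hpade : f.pade p q ζ = fun z => N.eval z / D.eval z := by
    ext z
    simp [hN, hDe, pade, padeNum]
  have hD0 : D ≠ 0 := by
    intro h
    have h1 : D.eval (ζ : ℂ) = 1 := by
      rw [hDe, padeDen, sub_self, ← coeff_zero_eq_eval_zero, padePair_den_coeff_zero]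
    simp [h] at h1
  have hDK : ∀ z ∈ closure Ω ∩ Metric.closedBall (0 : ℂ) m, D.eval z ≠ 0 := by
    rintro z ⟨hz, hz'⟩
    rw [hDe]
    exact (hK ⟨z, hz⟩ (by simpa [closurePart] using hz')).1
  obtain ⟨A, B, hB, hAB⟩ := exists_rational_approx_push_poles (N := N) (Nat.cast_nonneg m) hD0 hDK n
    (half_pos hε)
  have hV : IsOpen {z : ℂ | B.eval z ≠ 0} := isOpen_ne_fun B.continuous continuous_const
  have hd : DifferentiableOn ℂ (fun z => A.eval z / B.eval z) {z : ℂ | B.eval z ≠ 0} :=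
    differentiableOn_polynomial_div A B fun z hz => hz
  refine ⟨ofHolomorphic hΩ hV hB _ hd, ofHolomorphic_mem _ _ _ _ _, fun l hl z hz => ?_⟩
  have hzm : z ∈ closurePart Ω m :=
    le_trans (b := (n : ℝ)) hz (Nat.cast_le.2 hnm)
  rw [extDeriv_eq_iteratedDeriv hΩ hV hB hd fun _ => rfl]
  have h1 := hAB l hl z ⟨z.2, by simpa [closurePart] using hzm⟩
  have h2 := ((hK z hzm).2 l (hl.trans hnm)).trans hm
  rw [hpade] at h2
  calc _ ≤ _ := norm_sub_le_norm_sub_add_norm_sub _ _ _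
    _ < ε / 2 + ε / 2 := add_lt_add h1 h2
    _ = ε := add_halves ε

theorem holomorphicNearClosure_subset_closure (hΩ : IsOpen Ω) {F : Set (ℕ × ℕ)}
    (hF : ∃ p q : ℕ → ℕ, (∀ n, (p n, q n) ∈ F) ∧ Tendsto p atTop atTop ∧ Tendsto q atTop atTop)
    (ζ : closure Ω) :
    holomorphicNearClosure Ω ⊆ closure {f : AInfty Ω | f.IsApproximatedByPade F ζ} := by
  rintro f ⟨U, hU, hΩU, g, hg, hfg⟩
  refine mem_closure_of_approx fun n ε hε => ?_
  have hε3 : 0 < ε / 3 := by positivity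
  set K := closure Ω ∩ Metric.closedBall (0 : ℂ) n with hKdef
  have hK : IsCompact K := isCompact_image_closurePart Ω n
  obtain ⟨N₀, D₀, hD₀, hD₀K, hR⟩ := exists_rational_approx_iteratedDeriv hK hU
    (inter_subset_left.trans hΩU) hg n hε3
  obtain ⟨A, B, hB, hAB⟩ := exists_rational_approx_push_poles (N := N₀) (Nat.cast_nonneg n) hD₀
    hD₀K n hε3
  obtain ⟨N, D, hND, hD0, hloc⟩ := exists_coprime_local_form A B (hB ζ ζ.2)
  obtain ⟨p, q, hpqF, hp, hq⟩ := hF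
  -- The bound on `p i` makes the added term `C d * X ^ T * D` dominate `N` and keeps the
  -- subtraction in `T` from truncating; it also gives `0 < p i`.
  obtain ⟨i, hpi, hqi⟩ := ((hp.eventually_gt_atTop (N.natDegree + D.natDegree)).and
    (hq.eventually_ge_atTop D.natDegree)).exists
  set T := p i - D.natDegree with hT
  set h : ℂ → ℂ := fun z => (z - ζ) ^ T with hh
  have hhd : Differentiable ℂ h := (differentiable_id.sub_const _).pow T
  have hhc (l : ℕ) : Continuous (iteratedDeriv l h) :=
    hhd.contDiff.continuous_iteratedDeriv l (n := ⊤) le_top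
  -- The punctured neighbourhood supplies `d ≠ 0`, without which the degree `p i` would be lost.
  have hsmall : ∀ᶠ d in 𝓝[≠] (0 : ℂ), ∀ z ∈ K, ∀ l ≤ n, ‖d * iteratedDeriv l h z‖ < ε / 3 := by
    refine nhdsWithin_le_nhds (hK.eventually_forall_of_forall_eventually fun z _ => ?_)
    refine (eventually_all_finite (Set.finite_Iic n)).2 fun l _ => ?_
    have hc : Continuous fun x : ℂ × ℂ => ‖x.1 * iteratedDeriv l h x.2‖ :=
      (continuous_fst.mul ((hhc l).comp continuous_snd)).norm
    exact hc.continuousAt.eventually_lt_const (by simpa using hε3)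
  obtain ⟨d, hd, hd0⟩ := (hsmall.and self_mem_nhdsWithin).exists
  have hD0' : D ≠ 0 := by
    rintro rfl
    simp at hD0
  have hdeg : (C d * X ^ T * D).natDegree = p i := by
    rw [mul_assoc, natDegree_C_mul hd0, natDegree_mul (pow_ne_zero _ X_ne_zero) hD0',
      natDegree_X_pow]
    omega
  set M := N + C d * X ^ T * D with hM
  have hMdeg : M.natDegree = p i := by
    rw [hM, natDegree_add_eq_right_of_natDegree_lt (by omega), hdeg]
  -- The numerator changes by a multiple of `D`, so the fraction stays irreducible with the same
  -- poles.
  have hMD : IsCoprime M D := hND.add_mul_right_left _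
  set r : ℂ → ℂ := fun z => M.eval (z - ζ) / D.eval (z - ζ) with hr
  have hV : IsOpen {z : ℂ | B.eval z ≠ 0} := isOpen_ne_fun B.continuous continuous_const
  have hre : ∀ z, B.eval z ≠ 0 → r z = A.eval z / B.eval z + d * h z := by
    intro z hz
    obtain ⟨h1, h2⟩ := hloc z hz
    rw [← h2]
    simp only [hr, hM, hh, eval_add, eval_mul, eval_C, eval_pow, eval_X]
    field_simp
  have hABd : DifferentiableOn ℂ (fun z => A.eval z / B.eval z) {z : ℂ | B.eval z ≠ 0} :=
    differentiableOn_polynomial_div A B fun z hz => hz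
  have hrd : DifferentiableOn ℂ r {z : ℂ | B.eval z ≠ 0} :=
    (hABd.add (hhd.const_mul d).differentiableOn).congr hre
  refine ⟨ofHolomorphic hΩ hV hB r hrd, isApproximatedByPade_of_rational hΩ (hpqF i) hMdeg
    (by omega) hqi hMD hD0 (fun z hz => (hloc z (hB z hz)).1) fun _ => rfl, fun l hl z hz => ?_⟩
  have hzK : (z : ℂ) ∈ K := ⟨z.2, by simpa [closurePart] using hz⟩
  have e : iteratedDeriv l r z =
      iteratedDeriv l (fun z => A.eval z / B.eval z) z + d * iteratedDeriv l h z := by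
    have h1 : r =ᶠ[𝓝 (z : ℂ)] (fun z => A.eval z / B.eval z) + fun z => d * h z := by
      filter_upwards [hV.mem_nhds (hB z z.2)] with w hw using hre w hw
    rw [h1.iteratedDeriv_eq, iteratedDeriv_add
      (hABd.analyticAt (hV.mem_nhds (hB z z.2))).contDiffAt
      (hhd.const_mul d).contDiff.contDiffAt, iteratedDeriv_const_mul_field]
  rw [extDeriv_eq_iteratedDeriv hΩ hV hB hrd fun _ => rfl,
    extDeriv_eq_iteratedDeriv hΩ hU hΩU hg hfg, e]
  have h1 := hd z hzK l hl
  have h2 := hAB l hl z hzK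
  have h3 := hR l hl z hzK
  set a := iteratedDeriv l (fun z => A.eval z / B.eval z) z
  set b := iteratedDeriv l (fun z => N₀.eval z / D₀.eval z) z
  calc ‖a + d * iteratedDeriv l h z - iteratedDeriv l g z‖
      = ‖(d * iteratedDeriv l h z + (a - b)) + (b - iteratedDeriv l g z)‖ := by
        congr 1
        ring
    _ ≤ ‖d * iteratedDeriv l h z‖ + ‖a - b‖ + ‖b - iteratedDeriv l g z‖ := norm_add₃_le
    _ < ε / 3 + ε / 3 + ε / 3 := by linarith
    _ = ε := by ring

end AInfty

end

theorem theorem6p5 (Ω : Set ℂ) (hΩ : IsOpen Ω) (F : Set (ℕ × ℕ))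
    (hF : ∃ p q : ℕ → ℕ, (∀ n, (p n, q n) ∈ F) ∧ Tendsto p atTop atTop ∧ Tendsto q atTop atTop)
    (ζ₀ : closure Ω) :
    (∃ f : AInfty Ω, f.IsApproximatedByPade F ζ₀) ∧
    {f : AInfty Ω | f.IsApproximatedByPade F ζ₀} ⊆ XInfty Ω ∧
    IsGδ {f : XInfty Ω | (f : AInfty Ω).IsApproximatedByPade F ζ₀} ∧
    Dense {f : XInfty Ω | (f : AInfty Ω).IsApproximatedByPade F ζ₀} := by
  have hsub : {f : AInfty Ω | f.IsApproximatedByPade F ζ₀} ⊆ XInfty Ω :=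
    fun _ hf => AInfty.mem_XInfty_of_isApproximatedByPade hΩ hf
  have hdense : XInfty Ω ⊆ closure {f : AInfty Ω | f.IsApproximatedByPade F ζ₀} :=
    closure_minimal (AInfty.holomorphicNearClosure_subset_closure hΩ hF ζ₀) isClosed_closure
  refine ⟨?_, hsub, ?_, ?_⟩
  · have h0 : AInfty.ofHolomorphic hΩ isOpen_univ (subset_univ _) 0
        (differentiable_const (0 : ℂ)).differentiableOn ∈ XInfty Ω :=
      subset_closure (AInfty.ofHolomorphic_mem _ _ _ _ _)
    -- Existence follows from density, as `X^∞` contains the zero function.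
    exact closure_nonempty_iff.1 ⟨_, hdense h0⟩
  · exact IsGδ.preimage (f := fun f : XInfty Ω => (f : AInfty Ω)) continuous_subtype_val
      (AInfty.isGδ_isApproximatedByPade F ζ₀)
  · rw [Subtype.dense_iff]
    refine hdense.trans (closure_mono fun f hf => ⟨⟨f, hsub hf⟩, hf, rfl⟩)
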